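/- **Setting.** Let $\Omega\subset\mathbb R^3$ be open and $q\in C^1(\Omega,\mathbb R)$. For $\mathbf x=(x,y,z)$ and $\mathbf Q=(u,v,w)$ consider the real three-dimensional Riccati system $$E_1\equiv-(u_x+v_y+w_z)+u^2+v^2+w^2-q=0,\quad E_2\equiv w_y-v_z=0,\quad E_3\equiv u_z-w_x=0,\quad E_4\equiv v_x-u_y=0 .$$ A solution on an open set $U$ is a $C^1$ map $\mathbf Q:U\to\mathbb R^3$ satisfying it. For an open $M\subset\Omega\times\mathbb R^3$, a Lie point symmetry generator on $M$ is a $C^\infty$ vector field $\widehat v=\xi\partial_x+\eta\partial_y+\tau\partial_z+\phi\partial_u+\psi\partial_v+\zeta\partial_w$ on $M$ whose first prolongation satisfies $\mathrm{pr}^{(1)}\widehat v\cdot E_i=0$ ($i=1,\dots,4$) at every first-order jet over $M$ at which $E_1=\dots=E_4=0$. Write $r^2=x^2+y^2+z^2$, $c(\mathbf x,\mathbf Q)=1-2\langle\mathbf x,\mathbf Q\rangle$, $\alpha(s,r,\lambda)=r^2\lambda^2-2s\lambda+1$, and let $\mathbf e_1,\mathbf e_2,\mathbf e_3$ be the standard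 basis. Let $$\begin{aligned} &\widehat v_1=\partial_x,\quad \widehat v_2=\partial_y,\quad \widehat v_3=\partial_z,\\ &\widehat v_4=y\partial_z-z\partial_y+v\partial_w-w\partial_v,\quad \widehat v_5=z\partial_x-x\partial_z+w\partial_u-u\partial_w,\quad \widehat v_6=x\partial_y-y\partial_x+u\partial_v-v\partial_u,\\ &\widehat v_7=x\partial_x+y\partial_y+z\partial_z-u\partial_u-v\partial_v-w\partial_w,\\ &\widehat v_8=[x^2-(y^2+z^2)]\partial_x+2xy\partial_y+2xz\partial_z+c\,\partial_u+2(yu-xv)\partial_v+2(zu-xw)\partial_w,\\ &\widehat v_9=2xy\partial_x+[y^2-(x^2+z^2)]\partial_y+2yz\partial_z+2(xv-yu)\partial_u+c\,\partial_v+2(zv-yw)\partial_w,\\ &\widehat v_{10}=2xz\partial_x+2yz\partial_y+[z^2-(x^2+y^2)]\partial_z+2(xw-zu)\partial_u+2(yw-zv)\partial_v+c\,\partial_w . \end{aligned}$$ **(1) Generators.** Let $M\subset\Omega\times\mathbb R^3$ be open, connected and non-empty. A vector field $\widehat v$ on $M$ is a Lie point symmetry generator if and only if there are real parameters $a_1,\dots,a_{10}$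 (then unique) such that on $M$ $$\begin{aligned} \widehat v={}&[a_1(x^2-(y^2+z^2))+2a_2xy+2a_3xz-a_4z+a_5x-a_6y+a_9]\partial_x\\ &+[2a_1xy+a_2(y^2-(x^2+z^2))+2a_3yz+a_5y+a_6x-a_7z+a_{10}]\partial_y\\ &+[2a_1xz+2a_2yz+a_3(z^2-(x^2+y^2))+a_4x+a_5z+a_7y+a_8]\partial_z\\ &+[a_1c+2a_2(xv-yu)+2a_3(xw-zu)-a_4w-a_5u-a_6v]\partial_u\\ &+[2a_1(yu-xv)+a_2c-2a_3(zv-yw)-a_5v+a_6u-a_7w]\partial_v\\ &+[2a_1(zu-xw)+2a_2(zv-yw)+a_3c+a_4u-a_5w+a_7v]\partial_w , \end{aligned}$$ with $c=c(\mathbf x,\mathbf Q)$, and, at every point of the projection of $M$ to $\Omega$, $$\begin{aligned} &[a_1(y^2+z^2-x^2)-2a_2xy-2a_3xz+a_4z-a_5x+a_6y-a_9]\,q_x\\ &+[-2a_1xy+a_2(x^2+z^2-y^2)-2a_3yz-a_5y-a_6x+a_7z-a_{10}]\,q_y\\ &+[-2a_1xz-2a_2yz+a_3(x^2+y^2-z^2)-a_4x-a_5z-a_7y-a_8]\,q_z\\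 &-2[a_5+2(a_1x+a_2y+a_3z)]\,q=0 . \end{aligned}$$ The ten-parameter field equals $a_9\widehat v_1+a_{10}\widehat v_2+a_8\widehat v_3+a_7\widehat v_4-a_4\widehat v_5+a_6\widehat v_6+a_5\widehat v_7+a_1\widehat v_8+a_2\widehat v_9+a_3\widehat v_{10}$, a combination of translations, simultaneous rotations, a dilation and three conical fields. **(2) Potentials.** For $k=1,\dots,10$ let $D_k\subset\mathbb R^3$ and the form of $q$ be $$\begin{aligned} &k=1,2,3:\ D_k=\mathbb R^3,\quad q=F(y,z),\ F(x,z),\ F(x,y)\ \text{respectively};\\ &k=4,5,6:\ D_k=\mathbb R^3,\quad q=F(x,\sqrt{y^2+z^2}),\ F(y,\sqrt{x^2+z^2}),\ F(z,\sqrt{x^2+y^2})\ \text{respectively};\\ &k=7:\ D_7=\{x\ne0\},\quad q=x^{-2}F(y/x,z/x);\\ &k=8,9,10:\ D_k=\mathbb R^3\setminus\{0\},\quad q=r^{-4}F(\tfrac y{r^2},\tfrac z{r^2}),\ r^{-4}F(\tfrac x{r^2},\tfrac z{r^2}),\ r^{-4}F(\tfrac x{r^2},\tfrac y{r^2})\ \text{respectively}.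 \end{aligned}$$ Then $\widehat v_k$ is a Lie point symmetry generator on $\Omega\times\mathbb R^3$ if and only if every point of $\Omega\cap D_k$ has a neighbourhood on which $q$ has the $k$-th form for some real function $F$ of two variables. If moreover the level sets in $\Omega\cap D_k$ of the pair of arguments of $F$ are connected (or empty), this holds if and only if $q$ has the $k$-th form on all of $\Omega\cap D_k$ with a single $F$. **(3) Groups.** Let $\mathcal G_k(\lambda):(\mathbf x,\mathbf Q)\mapsto(\widetilde{\mathbf x},\widetilde{\mathbf Q})$ be given as follows. For $k=1,2,3$: $\widetilde{\mathbf x}=\mathbf x+\lambda\mathbf e_k$, $\widetilde{\mathbf Q}=\mathbf Q$. For $k=4,5,6$: $\widetilde{\mathbf x}=S\mathbf x$, $\widetilde{\mathbf Q}=S\mathbf Q$ with, respectively, $$S=\begin{pmatrix}1&0&0\\0&\cos\lambda&-\sin\lambda\\0&\sin\lambda&\cos\lambda\end{pmatrix},\quad\begin{pmatrix}\cos\lambda&0&\sin\lambda\\0&1&0\\-\sin\lambda&0&\cos\lambda\end{pmatrix},\quad\begin{pmatrix}\cos\lambda&-\sin\lambda&0\\\sin\lambda&\cos\lambda&0\\0&0&1\end{pmatrix}.$$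 For $k=7$: $\widetilde{\mathbf x}=e^\lambda\mathbf x$, $\widetilde{\mathbf Q}=e^{-\lambda}\mathbf Q$. For $k=7+i$, $i\in\{1,2,3\}$, with $\alpha=\alpha(x_i,r,\lambda)$ and $c=c(\mathbf x,\mathbf Q)$: $$\widetilde{\mathbf x}=\frac{\mathbf x-\lambda r^2\mathbf e_i}{\alpha},\quad \widetilde Q_i=Q_i+c\lambda-(r^2Q_i+c\,x_i)\lambda^2,\quad \widetilde Q_j=\alpha Q_j+x_j(2Q_i\lambda+c\lambda^2)\ (j\ne i),$$ defined where $\alpha\ne0$. Then $\mathcal G_k(0)$ is the identity, and for fixed $(\mathbf x,\mathbf Q)$ the curve $\lambda\mapsto\mathcal G_k(\lambda)(\mathbf x,\mathbf Q)$ is, wherever defined, an integral curve of $\widehat v_k$. For $k=7+i$, if $x_j=0$ for all $j\neq i$ and $1-x_i\lambda\ne0$, then $\widetilde{\mathbf x}=\frac{x_i}{1-x_i\lambda}\mathbf e_i$, $\widetilde Q_i=(1-x_i\lambda)[Q_i+\lambda(1-x_iQ_i)]$ and $\widetilde Q_j=(1-x_i\lambda)^2Q_j$ for $j\ne i$. **(4)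 Action on solutions.** Let $U\subset\Omega$ be open, $\lambda\in\mathbb R$, and let $g_s$ denote the action of $\mathcal G_k(s)$ on $\mathbf x$. Suppose that either (i) $\widehat v_k$ is a Lie point symmetry generator on $\Omega\times\mathbb R^3$ and, for all $\mathbf x\in U$ and all $s$ between $0$ and $\lambda$, $g_s(\mathbf x)$ is defined and lies in $\Omega$; or (ii) $q$ has the $k$-th form of (2) on $\Omega\cap D_k$ with a single $F$ and, for all $\mathbf x\in U$, $g_\lambda(\mathbf x)$ is defined and lies in $\Omega$. Then $g_\lambda(U)$ is open and, for every solution $\mathbf Q$ on $U$ of the Riccati system with potential $q$, the function $\mathbf Q^{(k)}$ which maps $\mathbf x$ to the $\widetilde{\mathbf Q}$-component of $\mathcal G_k(\lambda)$ at $\big(g_{-\lambda}(\mathbf x),\mathbf Q(g_{-\lambda}(\mathbf x))\big)$ is a solution on $g_\lambda(U)$ of the system with the same potential $q$; its graph is the image under $\mathcal G_k(\lambda)$ of the graph of $\mathbf Q$. -/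

import Mathlib

open scoped Topology ContDiff

noncomputable section

namespace Riccati3D

/-- Three-dimensional real space, used both for the independent variables `(x, y, z)` and for the
dependent variables `(u, v, w)`; the coordinates `0, 1, 2` are `x, y, z` (resp. `u, v, w`). -/
abbrev R3 := Fin 3 → ℝ

/-- First-order jets `(x, Q, P)`, where `P a i` stands for the derivative `∂ Q_a / ∂ x_i`. -/
abbrev Jet := R3 × R3 × (Fin 3 → R3)

/-- The partial derivative `∂_i f` of a scalar function on space. -/
def pd (i : Fin 3) (f : R3 → ℝ) (x : R3) : ℝ := fderiv ℝ f x (Pi.single i 1)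

/-- The first-order jet at `x` of a vector function `Q = (u, v, w)`. -/
def jetOf (Q : R3 → R3) (x : R3) : Jet := (x, Q x, fun a i => pd i (fun y => Q y a) x)

/-- The four left-hand sides of the real three-dimensional Riccati system, as functions of jets:
`-(u_x + v_y + w_z) + (u² + v² + w²) - q`, `w_y - v_z`, `u_z - w_x`, `v_x - u_y`. -/
def riccati (q : R3 → ℝ) (i : Fin 4) (j : Jet) : ℝ :=
  let x := j.1
  let Q := j.2.1
  let P := j.2.2
  ![-(P 0 0 + P 1 1 + P 2 2) + (Q 0 ^ 2 + Q 1 ^ 2 + Q 2 ^ 2) - q x,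
    P 2 1 - P 1 2,
    P 0 2 - P 2 0,
    P 1 0 - P 0 1] i

/-- `Q` is a (classical, `C¹`) solution on `U` of the Riccati system with potential `q`. -/
def IsSolution (q : R3 → ℝ) (U : Set R3) (Q : R3 → R3) : Prop :=
  ContDiffOn ℝ 1 Q U ∧ ∀ x ∈ U, ∀ i, riccati q i (jetOf Q x) = 0

/-- Vector fields `ξ ∂_x + η ∂_y + τ ∂_z + φ ∂_u + ψ ∂_v + ζ ∂_w` on the space of independent and
dependent variables, given by their coefficients `((ξ, η, τ), (φ, ψ, ζ))` at `(x, Q)`. -/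
abbrev VField := R3 × R3 → R3 × R3

/-- The total derivative `D_i f = ∂_{x_i} f + ∑ₐ (∂_i Q_a) ∂_{Q_a} f`. -/
def totalDeriv (i : Fin 3) (f : R3 × R3 → ℝ) (j : Jet) : ℝ :=
  fderiv ℝ f (j.1, j.2.1) (Pi.single i 1, fun a => j.2.2 a i)

/-- The coefficient of `∂ / ∂(∂_i Q_a)` in the first prolongation of `X`:
`D_i (φ_a - ∑ₖ ξᵏ ∂ₖ Q_a) + ∑ₖ ξᵏ ∂ᵢ ∂ₖ Q_a = D_i φ_a - ∑ₖ (D_i ξᵏ) ∂ₖ Q_a`. -/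
def prolongCoeff (X : VField) (j : Jet) (a i : Fin 3) : ℝ :=
  totalDeriv i (fun p => (X p).2 a) j - ∑ k, totalDeriv i (fun p => (X p).1 k) j * j.2.2 a k

/-- The first prolongation of `X` applied to a function `E` of jets. -/
def prolong (X : VField) (E : Jet → ℝ) (j : Jet) : ℝ :=
  fderiv ℝ E j ((X (j.1, j.2.1)).1, (X (j.1, j.2.1)).2, prolongCoeff X j)

/-- `X` is the generator of a Lie point symmetry, over the region `M` of the space of independent
and dependent variables, of the Riccati system with potential `q`: a smooth vector field whose
first prolongation annihilates all equations of the system at all jets satisfying the system. -/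
def IsLieSymmetry (q : R3 → ℝ) (M : Set (R3 × R3)) (X : VField) : Prop :=
  ContDiffOn ℝ ∞ X M ∧
    ∀ j : Jet, (j.1, j.2.1) ∈ M → (∀ i, riccati q i j = 0) → ∀ i, prolong X (riccati q i) j = 0

/-- The ten-parameter vector field; `a 0, …, a 9` are the parameters `a_1, …, a_10`. -/
def genField (a : Fin 10 → ℝ) : VField := fun p =>
  let x := p.1 0
  let y := p.1 1
  let z := p.1 2
  let u := p.2 0
  let v := p.2 1
  let w := p.2 2
  (![a 0 * (x ^ 2 - (y ^ 2 + z ^ 2)) + 2 * a 1 * x * y + 2 * a 2 * x * z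
        - a 3 * z + a 4 * x - a 5 * y + a 8,
     2 * a 0 * x * y + a 1 * (y ^ 2 - (x ^ 2 + z ^ 2)) + 2 * a 2 * y * z
        + a 4 * y + a 5 * x - a 6 * z + a 9,
     2 * a 0 * x * z + 2 * a 1 * y * z + a 2 * (z ^ 2 - (x ^ 2 + y ^ 2))
        + a 3 * x + a 4 * z + a 6 * y + a 7],
   ![a 0 * (1 - 2 * (x * u + y * v + z * w)) + 2 * a 1 * (x * v - y * u)
        + 2 * a 2 * (x * w - z * u) - a 3 * w - a 4 * u - a 5 * v,
     2 * a 0 * (y * u - x * v) + a 1 * (1 - 2 * (x * u + y * v + z * w))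
        - 2 * a 2 * (z * v - y * w) - a 4 * v + a 5 * u - a 6 * w,
     2 * a 0 * (z * u - x * w) + 2 * a 1 * (z * v - y * w)
        + a 2 * (1 - 2 * (x * u + y * v + z * w)) + a 3 * u - a 4 * w + a 6 * v])

/-- The first-order condition on the potential, at the point `p`. -/
def CondQ (a : Fin 10 → ℝ) (q : R3 → ℝ) (p : R3) : Prop :=
  let x := p 0
  let y := p 1
  let z := p 2
  (a 0 * (y ^ 2 + z ^ 2 - x ^ 2) - 2 * a 1 * x * y - 2 * a 2 * x * z
      + a 3 * z - a 4 * x + a 5 * y - a 8) * pd 0 q p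
  + (-2 * a 0 * x * y + a 1 * (x ^ 2 + z ^ 2 - y ^ 2) - 2 * a 2 * y * z
      - a 4 * y - a 5 * x + a 6 * z - a 9) * pd 1 q p
  + (-2 * a 0 * x * z - 2 * a 1 * y * z + a 2 * (x ^ 2 + y ^ 2 - z ^ 2)
      - a 3 * x - a 4 * z - a 6 * y - a 7) * pd 2 q p
  - 2 * (a 4 + 2 * (a 0 * x + a 1 * y + a 2 * z)) * q p = 0

/-- `r² = x² + y² + z²`. -/
def rsq (x : R3) : ℝ := x 0 ^ 2 + x 1 ^ 2 + x 2 ^ 2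

/-- `c(x, Q) = 1 - 2 ⟨x, Q⟩`. -/
def cfun (x Q : R3) : ℝ := 1 - 2 * (x 0 * Q 0 + x 1 * Q 1 + x 2 * Q 2)

/-- The ten vector fields of the table; index `k` is the field number `k + 1`. -/
def tableField (k : Fin 10) : VField := fun p =>
  let x := p.1 0
  let y := p.1 1
  let z := p.1 2
  let u := p.2 0
  let v := p.2 1
  let w := p.2 2
  let c := cfun p.1 p.2
  ![(![1, 0, 0], ![0, 0, 0]),
    (![0, 1, 0], ![0, 0, 0]),
    (![0, 0, 1], ![0, 0, 0]),
    (![0, -z, y], ![0, -w, v]),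
    (![z, 0, -x], ![w, 0, -u]),
    (![-y, x, 0], ![-v, u, 0]),
    (![x, y, z], ![-u, -v, -w]),
    (![x ^ 2 - (y ^ 2 + z ^ 2), 2 * x * y, 2 * x * z],
      ![c, 2 * (y * u - x * v), 2 * (z * u - x * w)]),
    (![2 * x * y, y ^ 2 - (x ^ 2 + z ^ 2), 2 * y * z],
      ![2 * (x * v - y * u), c, 2 * (z * v - y * w)]),
    (![2 * x * z, 2 * y * z, z ^ 2 - (x ^ 2 + y ^ 2)],
      ![2 * (x * w - z * u), 2 * (y * w - z * v), c])] k

/-- The region in which the expression of the potential in row `k` of the table is defined: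
everything for the first six rows, `x ≠ 0` for the dilation, `r ≠ 0` for the conical fields. -/
def tableRegion (k : Fin 10) : Set R3 :=
  ![Set.univ, Set.univ, Set.univ, Set.univ, Set.univ, Set.univ,
    {p | p 0 ≠ 0}, {p | p ≠ 0}, {p | p ≠ 0}, {p | p ≠ 0}] k

/-- The two invariants on which the arbitrary function of row `k` of the table depends. -/
def tableInvariant (k : Fin 10) (p : R3) : ℝ × ℝ :=
  let x := p 0
  let y := p 1
  let z := p 2
  ![(y, z), (x, z), (x, y),
    (x, √(y ^ 2 + z ^ 2)), (y, √(x ^ 2 + z ^ 2)), (z, √(x ^ 2 + y ^ 2)),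
    (y / x, z / x),
    (y / rsq p, z / rsq p), (x / rsq p, z / rsq p), (x / rsq p, y / rsq p)] k

/-- The prefactor of the arbitrary function in row `k` of the table: `1`, `x⁻²` or `r⁻⁴`. -/
def tableFactor (k : Fin 10) (p : R3) : ℝ :=
  ![1, 1, 1, 1, 1, 1, (p 0 ^ 2)⁻¹, (rsq p ^ 2)⁻¹, (rsq p ^ 2)⁻¹, (rsq p ^ 2)⁻¹] k

/-- The potential in row `k` of the table built on the arbitrary function `F` of two variables. -/
def tablePotential (k : Fin 10) (F : ℝ × ℝ → ℝ) (p : R3) : ℝ :=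
  tableFactor k p * F (tableInvariant k p)

/-- `α(s, r, t) = r² t² - 2 s t + 1`, here as a function of `s`, of `r²` and of `t`. -/
def alpha (s r2 t : ℝ) : ℝ := r2 * t ^ 2 - 2 * s * t + 1

/-- The denominator in the `k`-th group (`1` if there is none). -/
def groupDen (k : Fin 10) (t : ℝ) (p : R3) : ℝ :=
  ![1, 1, 1, 1, 1, 1, 1,
    alpha (p 0) (rsq p) t, alpha (p 1) (rsq p) t, alpha (p 2) (rsq p) t] k

/-- The action of the `k`-th group, with parameter `t`, on the independent variables. -/
def groupX (k : Fin 10) (t : ℝ) (p : R3) : R3 :=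
  let x := p 0
  let y := p 1
  let z := p 2
  let c := Real.cos t
  let s := Real.sin t
  let d := groupDen k t p
  ![![x + t, y, z],
    ![x, y + t, z],
    ![x, y, z + t],
    ![x, c * y - s * z, s * y + c * z],
    ![c * x + s * z, y, -s * x + c * z],
    ![c * x - s * y, s * x + c * y, z],
    ![Real.exp t * x, Real.exp t * y, Real.exp t * z],
    ![(x - t * rsq p) / d, y / d, z / d],
    ![x / d, (y - t * rsq p) / d, z / d],
    ![x / d, y / d, (z - t * rsq p) / d]] k

/-- The action of the `k`-th group, with parameter `t`, on the dependent variables `Q` over `p`. -/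
def groupQ (k : Fin 10) (t : ℝ) (p Q : R3) : R3 :=
  let x := p 0
  let y := p 1
  let z := p 2
  let u := Q 0
  let v := Q 1
  let w := Q 2
  let c := Real.cos t
  let s := Real.sin t
  let d := groupDen k t p
  let C := cfun p Q
  ![![u, v, w],
    ![u, v, w],
    ![u, v, w],
    ![u, c * v - s * w, s * v + c * w],
    ![c * u + s * w, v, -s * u + c * w],
    ![c * u - s * v, s * u + c * v, w],
    ![Real.exp (-t) * u, Real.exp (-t) * v, Real.exp (-t) * w],
    ![u + C * t - (rsq p * u + C * x) * t ^ 2,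
      d * v + y * (2 * u * t + C * t ^ 2),
      d * w + z * (2 * u * t + C * t ^ 2)],
    ![d * u + x * (2 * v * t + C * t ^ 2),
      v + C * t - (rsq p * v + C * y) * t ^ 2,
      d * w + z * (2 * v * t + C * t ^ 2)],
    ![d * u + x * (2 * w * t + C * t ^ 2),
      d * v + y * (2 * w * t + C * t ^ 2),
      w + C * t - (rsq p * w + C * z) * t ^ 2]] k

/-- The transform of the function `Q` by the element of parameter `t` of the `k`-th group: the
function whose graph consists of the points `(x̃, Q̃)` obtained from the points `(x, Q(x))`, the
point `x` being recovered from `x̃` by the element of parameter `-t`. -/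
def transform (k : Fin 10) (t : ℝ) (Q : R3 → R3) : R3 → R3 :=
  fun p => groupQ k t (groupX k (-t) p) (Q (groupX k (-t) p))

/-- The element of parameter `t` of the `k`-th group maps the solutions on `U` of the Riccati
system with potential `q` to solutions of the same system on the (open) image of `U`. -/
def MapsSolutions (q : R3 → ℝ) (k : Fin 10) (t : ℝ) (U : Set R3) : Prop :=
  IsOpen (groupX k t '' U) ∧
    ∀ Q : R3 → R3, IsSolution q U Q →
      IsSolution q (groupX k t '' U) (transform k t Q) ∧
        ∀ p ∈ U, transform k t Q (groupX k t p) = groupQ k t p (Q p)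

end Riccati3D

end

open Riccati3D

/-! Over a point of `M` the prolongation coefficients of a generator are quadratic polynomials in
the first-order jet `P`, and the invariance condition must hold for all symmetric `P` of trace `|Q|²
- q`. Comparing coefficients (`determining_algebra`) shows that the spatial part `ξ` does not depend
on `Q` and is a conformal Killing field, and that `∂φ_a/∂Q_b = σ δ_ab - ∂_a ξ_b`. In dimension three
the third derivatives of a conformal Killing field vanish (Liouville), which leaves ten parameters.
The remaining scalar equation contains `q` and `∇q` only as constants along the fibre, so it may be
differentiated twice in `Q` although `q` is merely `C¹`; this gives `σ = 0` and expresses `φ`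
through `ξ`. What survives of the equation is the linear condition on `q`.

For a single field the condition is an ordinary differential equation along the orbits: `q` is
multiplied by a known weight (`potential_groupX`). The prefactor of the table has the same weight
and its two arguments are invariant, so the quotient of `q` by the prefactor is constant on orbit
pieces inside `Ω`. The local form follows once nearby points with equal invariants are joined by an
orbit piece inside `Ω` (`exists_nhds_orbit`).

Behind the action on solutions stands the substitution `Q = -∇ψ/ψ`, which turns the system into `Δψ
= qψ`: the groups are conformal maps, and `Q` transforms as a covector up to an inhomogeneous term.
In the proof this appears as two algebraic identities for the transformed jet: symmetry is preserved
(`groupJet_comm`), and `-div Q + |Q|²` is multiplied by the same weight as `q` (`groupJet_trace`).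
-/

namespace Riccati3D

/-! ### Directional derivatives read off along lines -/

section Line

variable {E : Type*} [NormedAddCommGroup E] [NormedSpace ℝ E]

theorem fderiv_apply_eq_of_hasDerivAt_line {f : E → ℝ} {x v : E} {c : ℝ}
    (hf : DifferentiableAt ℝ f x) (h : HasDerivAt (fun s : ℝ => f (x + s • v)) c 0) :
    fderiv ℝ f x v = c :=
  (hf.hasFDerivAt.hasLineDerivAt v).unique h

/-- The equations (apart from `q`) and the ten-parameter field are polynomials of degree at most
two, so this reduces their differentiation to an identity for `ring`. -/
theorem fderiv_apply_eq_of_quadratic {f : E → ℝ} {x v : E} (c₁ c₂ : ℝ)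
    (hf : DifferentiableAt ℝ f x) (h : ∀ s : ℝ, f (x + s • v) = f x + c₁ * s + c₂ * s ^ 2) :
    fderiv ℝ f x v = c₁ := by
  apply fderiv_apply_eq_of_hasDerivAt_line hf
  have h' : HasDerivAt (fun s : ℝ => f x + c₁ * s + c₂ * s ^ 2) c₁ 0 := by
    have := (((hasDerivAt_id (0 : ℝ)).const_mul c₁).const_add (f x)).add
      (((hasDerivAt_id (0 : ℝ)).pow 2).const_mul c₂)
    refine (this.congr_deriv (by simp)).congr_of_eventuallyEq (.of_forall fun s => ?_)
    simp
  exact h'.congr_of_eventuallyEq (.of_forall h)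

end Line

/-! ### The prolonged field applied to the four equations -/

theorem fderiv_eq_sum_pd (q : R3 → ℝ) (x v : R3) :
    fderiv ℝ q x v = v 0 * pd 0 q x + v 1 * pd 1 q x + v 2 * pd 2 q x := by
  have : v = v 0 • Pi.single 0 1 + v 1 • Pi.single 1 1 + v 2 • Pi.single 2 1 := by
    ext i; fin_cases i <;> simp
  conv_lhs => rw [this]
  simp [pd]

theorem differentiableAt_riccati {q : R3 → ℝ} {j : Jet} (hq : DifferentiableAt ℝ q j.1)
    (i : Fin 4) : DifferentiableAt ℝ (riccati q i) j := by
  have h : DifferentiableAt ℝ (fun j : Jet => q j.1) j := hq.comp j differentiableAt_fst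
  unfold riccati
  fin_cases i <;> simp <;> fun_prop

theorem fderiv_riccati_zero {q : R3 → ℝ} {j : Jet} (hq : DifferentiableAt ℝ q j.1)
    (ξ φ : R3) (π : Fin 3 → R3) :
    fderiv ℝ (riccati q 0) j (ξ, φ, π) = -(π 0 0 + π 1 1 + π 2 2)
      + 2 * (j.2.1 0 * φ 0 + j.2.1 1 * φ 1 + j.2.1 2 * φ 2) - fderiv ℝ q j.1 ξ := by
  have h : DifferentiableAt ℝ (fun j : Jet => q j.1) j := hq.comp j differentiableAt_fst
  have h0 := differentiableAt_riccati hq 0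
  have h1 : fderiv ℝ (fun j : Jet => q j.1) j (ξ, φ, π) = fderiv ℝ q j.1 ξ := by
    have := (hq.hasFDerivAt.comp j hasFDerivAt_fst).fderiv
    simp only [Function.comp_def] at this
    rw [this]; simp
  rw [← h1]
  -- Adding `q` back leaves a quadratic polynomial in the jet.
  have h2 : fderiv ℝ (fun j : Jet => riccati q 0 j + q j.1) j (ξ, φ, π)
      = -(π 0 0 + π 1 1 + π 2 2)
      + 2 * (j.2.1 0 * φ 0 + j.2.1 1 * φ 1 + j.2.1 2 * φ 2) := by
    refine fderiv_apply_eq_of_quadratic _ (φ 0 ^ 2 + φ 1 ^ 2 + φ 2 ^ 2) (h0.add h) fun s => ?_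
    simp [riccati]; ring
  rw [← h2, fderiv_fun_add h0 h]
  simp

theorem fderiv_riccati_one {q : R3 → ℝ} {j : Jet} (hq : DifferentiableAt ℝ q j.1)
    (ξ φ : R3) (π : Fin 3 → R3) :
    fderiv ℝ (riccati q 1) j (ξ, φ, π) = π 2 1 - π 1 2 :=
  fderiv_apply_eq_of_quadratic _ 0 (differentiableAt_riccati hq 1) fun s => by
    simp [riccati]; ring

theorem fderiv_riccati_two {q : R3 → ℝ} {j : Jet} (hq : DifferentiableAt ℝ q j.1)
    (ξ φ : R3) (π : Fin 3 → R3) :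
    fderiv ℝ (riccati q 2) j (ξ, φ, π) = π 0 2 - π 2 0 :=
  fderiv_apply_eq_of_quadratic _ 0 (differentiableAt_riccati hq 2) fun s => by
    simp [riccati]; ring

theorem fderiv_riccati_three {q : R3 → ℝ} {j : Jet} (hq : DifferentiableAt ℝ q j.1)
    (ξ φ : R3) (π : Fin 3 → R3) :
    fderiv ℝ (riccati q 3) j (ξ, φ, π) = π 1 0 - π 0 1 :=
  fderiv_apply_eq_of_quadratic _ 0 (differentiableAt_riccati hq 3) fun s => by
    simp [riccati]; ring

/-- The prolonged field annihilates the four equations at `j`, written out. -/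
theorem prolong_riccati_eq_zero_iff {q : R3 → ℝ} {X : VField} {j : Jet}
    (hq : DifferentiableAt ℝ q j.1) :
    (∀ i, prolong X (riccati q i) j = 0) ↔
      (-(prolongCoeff X j 0 0 + prolongCoeff X j 1 1 + prolongCoeff X j 2 2)
        + 2 * (j.2.1 0 * (X (j.1, j.2.1)).2 0 + j.2.1 1 * (X (j.1, j.2.1)).2 1
          + j.2.1 2 * (X (j.1, j.2.1)).2 2) - fderiv ℝ q j.1 (X (j.1, j.2.1)).1 = 0) ∧
      ∀ a i, prolongCoeff X j a i = prolongCoeff X j i a := by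
  constructor
  · intro h
    have h0 := h 0
    have h1 := h 1
    have h2 := h 2
    have h3 := h 3
    simp only [prolong] at h0 h1 h2 h3
    rw [fderiv_riccati_zero hq] at h0
    rw [fderiv_riccati_one hq] at h1
    rw [fderiv_riccati_two hq] at h2
    rw [fderiv_riccati_three hq] at h3
    refine ⟨h0, fun a i => ?_⟩
    fin_cases a <;> fin_cases i <;> simp <;> linarith
  · rintro ⟨h0, h⟩ i
    fin_cases i <;> simp only [prolong]
    · exact (fderiv_riccati_zero hq _ _ _).trans h0
    · exact (fderiv_riccati_one hq _ _ _).trans (sub_eq_zero.2 (h _ _))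
    · exact (fderiv_riccati_two hq _ _ _).trans (sub_eq_zero.2 (h _ _))
    · exact (fderiv_riccati_three hq _ _ _).trans (sub_eq_zero.2 (h _ _))

theorem riccati_eq_zero_iff {q : R3 → ℝ} {j : Jet} :
    (∀ i, riccati q i j = 0) ↔
      (j.2.2 0 0 + j.2.2 1 1 + j.2.2 2 2 = j.2.1 0 ^ 2 + j.2.1 1 ^ 2 + j.2.1 2 ^ 2 - q j.1) ∧
      ∀ a i, j.2.2 a i = j.2.2 i a := by
  constructor
  · intro h
    have h0 := h 0
    have h1 := h 1
    have h2 := h 2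
    have h3 := h 3
    simp [riccati] at h0 h1 h2 h3
    refine ⟨by linarith, fun a i => ?_⟩
    fin_cases a <;> fin_cases i <;> simp <;> linarith
  · rintro ⟨h0, h⟩ i
    have h1 := h 2 1
    have h2 := h 0 2
    have h3 := h 1 0
    fin_cases i <;> simp [riccati] <;> linarith

/-- Unit vectors in the directions of the independent variables. -/
def ex (i : Fin 3) : R3 × R3 := (Pi.single i 1, 0)

/-- Unit vectors in the directions of the dependent variables. -/
def eQ (b : Fin 3) : R3 × R3 := (0, Pi.single b 1)

theorem totalDeriv_eq (i : Fin 3) (f : R3 × R3 → ℝ) (j : Jet) :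
    totalDeriv i f j = fderiv ℝ f (j.1, j.2.1) (ex i)
      + ∑ b, fderiv ℝ f (j.1, j.2.1) (eQ b) * j.2.2 b i := by
  have : ((Pi.single i 1, fun a => j.2.2 a i) : R3 × R3)
      = ex i + ∑ b, j.2.2 b i • eQ b := by
    ext l <;> fin_cases l <;> simp [ex, eQ, Fin.sum_univ_three]
  rw [totalDeriv, this]
  simp [mul_comm]

/-! ### The ten-parameter field -/

theorem contDiff_genField (a : Fin 10 → ℝ) : ContDiff ℝ ∞ (genField a) := by
  refine ContDiff.prodMk ?_ ?_ <;> refine contDiff_pi.2 fun k => ?_ <;> fin_cases k <;> simp <;>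
    fun_prop

theorem differentiable_genField_fst (a : Fin 10 → ℝ) (k : Fin 3) :
    Differentiable ℝ fun m => (genField a m).1 k :=
  differentiable_pi.1 ((contDiff_genField a).differentiable (by simp)).fst k

theorem differentiable_genField_snd (a : Fin 10 → ℝ) (k : Fin 3) :
    Differentiable ℝ fun m => (genField a m).2 k :=
  differentiable_pi.1 ((contDiff_genField a).differentiable (by simp)).snd k

/-- The matrix of the derivatives of the spatial part of the ten-parameter field. -/
def genMatrix (a : Fin 10 → ℝ) (x : R3) : Fin 3 → R3 :=
  ![![a 4 + 2 * (a 0 * x 0 + a 1 * x 1 + a 2 * x 2), -2 * a 0 * x 1 + 2 * a 1 * x 0 - a 5,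
      -2 * a 0 * x 2 + 2 * a 2 * x 0 - a 3],
    ![2 * a 0 * x 1 - 2 * a 1 * x 0 + a 5, a 4 + 2 * (a 0 * x 0 + a 1 * x 1 + a 2 * x 2),
      -2 * a 1 * x 2 + 2 * a 2 * x 1 - a 6],
    ![2 * a 0 * x 2 - 2 * a 2 * x 0 + a 3, 2 * a 1 * x 2 - 2 * a 2 * x 1 + a 6,
      a 4 + 2 * (a 0 * x 0 + a 1 * x 1 + a 2 * x 2)]]

theorem fderiv_genField_fst (a : Fin 10 → ℝ) (k : Fin 3) (m v : R3 × R3) :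
    fderiv ℝ (fun m => (genField a m).1 k) m v = ∑ i, genMatrix a m.1 k i * v.1 i := by
  -- The coefficient of `s ^ 2` is the homogeneous quadratic part of the field, evaluated at `v`.
  refine fderiv_apply_eq_of_quadratic _ ((genField a (v.1, 0)).1 k - ∑ i, genMatrix a 0 k i * v.1 i
    - (genField a 0).1 k) (differentiable_genField_fst a k m) fun s => ?_
  fin_cases k <;> simp [genField, genMatrix, Fin.sum_univ_three] <;> ring

/-- The dependent part of the field is `-(Dξ)ᵀ Q` plus the constant vector `(a 0, a 1, a 2)`, and
`genMatrix` is the affine function `Dξ` of `x`; the two sums are the product rule. -/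
theorem fderiv_genField_snd (a : Fin 10 → ℝ) (b : Fin 3) (m v : R3 × R3) :
    fderiv ℝ (fun m => (genField a m).2 b) m v = -∑ c, genMatrix a m.1 c b * v.2 c
      - ∑ c, (genMatrix a v.1 c b - genMatrix a 0 c b) * m.2 c := by
  refine fderiv_apply_eq_of_quadratic _
    (- ∑ c, (genMatrix a v.1 c b - genMatrix a 0 c b) * v.2 c)
    (differentiable_genField_snd a b m) fun s => ?_
  fin_cases b <;> simp [genField, genMatrix, Fin.sum_univ_three] <;> ring

theorem prolongCoeff_genField (a : Fin 10 → ℝ) (j : Jet) (b i : Fin 3) :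
    prolongCoeff (genField a) j b i = -∑ c, genMatrix a j.1 c b * j.2.2 c i
      - ∑ c, (genMatrix a (Pi.single i 1) c b - genMatrix a 0 c b) * j.2.1 c
      - ∑ k, genMatrix a j.1 k i * j.2.2 b k := by
  simp only [prolongCoeff, totalDeriv, fderiv_genField_fst, fderiv_genField_snd]
  simp [Pi.single_apply]

theorem condQ_iff (a : Fin 10 → ℝ) (q : R3 → ℝ) (m : R3 × R3) :
    CondQ a q m.1 ↔ fderiv ℝ q m.1 (genField a m).1
      + 2 * (a 4 + 2 * (a 0 * m.1 0 + a 1 * m.1 1 + a 2 * m.1 2)) * q m.1 = 0 := by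
  rw [fderiv_eq_sum_pd, ← neg_eq_zero]
  simp only [CondQ, genField]
  apply Eq.congr _ rfl
  simp
  ring

/-- The curl equations are preserved for every `a`. With `κ = a 4 + 2 (a 0 x + a 1 y + a 2 z)`, the
first equation is reproduced with the factor `-2κ`, and the remainder is the condition on `q`. -/
theorem prolong_genField_eq_zero_iff (a : Fin 10 → ℝ) {q : R3 → ℝ} {j : Jet}
    (hq : DifferentiableAt ℝ q j.1) (hj : ∀ i, riccati q i j = 0) :
    (∀ i, prolong (genField a) (riccati q i) j = 0) ↔ CondQ a q j.1 := by
  rw [prolong_riccati_eq_zero_iff hq, condQ_iff a q (j.1, j.2.1)]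
  obtain ⟨h0, h1⟩ := riccati_eq_zero_iff.1 hj
  simp only [prolongCoeff_genField]
  have e1 := h1 2 1
  have e2 := h1 0 2
  have e3 := h1 1 0
  have sym : ∀ b i, -∑ c, genMatrix a j.1 c b * j.2.2 c i
      - ∑ c, (genMatrix a (Pi.single i 1) c b - genMatrix a 0 c b) * j.2.1 c
      - ∑ k, genMatrix a j.1 k i * j.2.2 b k = -∑ c, genMatrix a j.1 c i * j.2.2 c b
      - ∑ c, (genMatrix a (Pi.single b 1) c i - genMatrix a 0 c i) * j.2.1 c
      - ∑ k, genMatrix a j.1 k b * j.2.2 i k := by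
    intro b i
    fin_cases b <;> fin_cases i <;> simp [genMatrix, Fin.sum_univ_three, e1, e2, e3] <;> ring
  simp only [sym, implies_true, and_true]
  rw [← neg_eq_zero (a := _ + _)]
  apply Eq.congr _ rfl
  simp [genMatrix, genField, Fin.sum_univ_three, e1, e2, e3]
  linear_combination (2 * (a 4 + 2 * (a 0 * j.1 0 + a 1 * j.1 1 + a 2 * j.1 2))) * h0

/-- Prolongation involves derivatives of the field; openness turns equality on `M` into equality of
germs. -/
theorem isLieSymmetry_congr {q : R3 → ℝ} {M : Set (R3 × R3)} (hM : IsOpen M) {X Y : VField}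
    (h : Set.EqOn X Y M) : IsLieSymmetry q M X ↔ IsLieSymmetry q M Y := by
  refine and_congr (contDiffOn_congr h) (forall_congr' fun j => forall_congr' fun hj => ?_)
  have e : X =ᶠ[𝓝 (j.1, j.2.1)] Y := h.eventuallyEq_of_mem (hM.mem_nhds hj)
  have e1 : ∀ k, (fun m => (X m).1 k) =ᶠ[𝓝 (j.1, j.2.1)] fun m => (Y m).1 k := fun k =>
    e.mono fun m hm => by simp only [hm]
  have e2 : ∀ k, (fun m => (X m).2 k) =ᶠ[𝓝 (j.1, j.2.1)] fun m => (Y m).2 k := fun k =>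
    e.mono fun m hm => by simp only [hm]
  have e3 : prolongCoeff X j = prolongCoeff Y j := by
    ext a i
    simp only [prolongCoeff, totalDeriv, (e1 _).fderiv_eq, (e2 _).fderiv_eq]
  simp only [prolong, e.eq_of_nhds, e3]

/-- This makes the condition on `q` necessary: invariance is never vacuous over a point of `M`. -/
theorem exists_jet (q : R3 → ℝ) (x Q : R3) : ∃ P, ∀ i, riccati q i (x, Q, P) = 0 := by
  refine ⟨![![Q 0 ^ 2 + Q 1 ^ 2 + Q 2 ^ 2 - q x, 0, 0], 0, 0], riccati_eq_zero_iff.2 ⟨?_, ?_⟩⟩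
  · simp
  · intro a i
    fin_cases a <;> fin_cases i <;> simp

theorem isLieSymmetry_genField_iff {Ω : Set R3} (hΩ : IsOpen Ω) {q : R3 → ℝ}
    (hq : ContDiffOn ℝ 1 q Ω) {M : Set (R3 × R3)} (hM : M ⊆ Ω ×ˢ Set.univ) (a : Fin 10 → ℝ) :
    IsLieSymmetry q M (genField a) ↔ ∀ p ∈ Prod.fst '' M, CondQ a q p := by
  have hq' : ∀ m ∈ M, DifferentiableAt ℝ q m.1 := fun m hm =>
    (hq.contDiffAt (hΩ.mem_nhds (hM hm).1)).differentiableAt one_ne_zero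
  constructor
  · rintro ⟨-, h⟩ _ ⟨m, hm, rfl⟩
    obtain ⟨P, hP⟩ := exists_jet q m.1 m.2
    exact (prolong_genField_eq_zero_iff a (j := (m.1, m.2, P)) (hq' m hm) hP).1
      (h (m.1, m.2, P) hm hP)
  · intro h
    refine ⟨(contDiff_genField a).contDiffOn, fun j hj hj' => ?_⟩
    exact (prolong_genField_eq_zero_iff a (hq' _ hj) hj').2 (h _ ⟨_, hj, rfl⟩)

theorem genField_eq_sum (a : Fin 10 → ℝ) (m : R3 × R3) :
    genField a m =
        a 8 • tableField 0 m + a 9 • tableField 1 m + a 7 • tableField 2 m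
        + a 6 • tableField 3 m - a 3 • tableField 4 m + a 5 • tableField 5 m
        + a 4 • tableField 6 m
        + a 0 • tableField 7 m + a 1 • tableField 8 m + a 2 • tableField 9 m := by
  ext l <;> fin_cases l <;> simp [genField, tableField, cfun] <;> ring

/-! ### Linear algebra of the determining equations -/

/-- The linear algebra behind the determining equations: the consequences of the invariance
condition holding for all symmetric matrices `P` of prescribed trace. -/
theorem determining_algebra {A B C D : Fin 3 → Fin 3 → ℝ} {T R : ℝ} {W : (Fin 3 → R3) → Fin 3 → R3}
    (hW : ∀ P a i, W P a i = A a i + ∑ b, B a b * P b i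
      - ∑ k, (C k i + ∑ b, D k b * P b i) * P a k)
    (h : ∀ P : Fin 3 → R3, P 0 0 + P 1 1 + P 2 2 = T → (∀ a i, P a i = P i a) →
      W P 0 0 + W P 1 1 + W P 2 2 = R ∧ ∀ a i, W P a i = W P i a) :
    (∀ k b, D k b = 0) ∧
    (∀ a b, B a b = (if a = b then B 0 0 + C 0 0 else 0) - C b a) ∧
    (∀ i j, C i j + C j i = if i = j then 2 * C 0 0 else 0) ∧
    A 0 0 + A 1 1 + A 2 2 + T * (B 0 0 + C 0 0 - 2 * C 0 0) = R := by
  obtain ⟨τ, rfl⟩ : ∃ τ, T = 3 * τ := ⟨T / 3, by ring⟩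
  -- The symmetric matrices of trace `3τ` are `τ` times the identity plus a trace-free part with
  -- five free entries.
  have key : ∀ x y l m n : ℝ, _ := fun x y l m n =>
    h ![![τ + x, l, m], ![l, τ + y, n], ![m, n, τ - x - y]] (by simp; ring) (by
      intro a i; fin_cases a <;> fin_cases i <;> simp)
  have tr := fun x y l m n => (key x y l m n).1
  have s1 := fun x y l m n => (key x y l m n).2 2 1
  have s2 := fun x y l m n => (key x y l m n).2 0 2
  have s3 := fun x y l m n => (key x y l m n).2 1 0
  simp [hW, Fin.sum_univ_three] at tr s1 s2 s3
  clear key h hW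
  -- The quadratic part of `W` is `-P D P`. Second differences isolate it on trace-free symmetric
  -- `N`: symmetry of `N D N` for diagonal `N` makes `D` symmetric, and `tr (D N²) = 0` then makes
  -- it vanish.
  have d0 : ∀ k b, D k b = 0 := by
    have d1 : D 0 1 = D 1 0 := by linarith [s3 1 1 0 0 0, s3 (-1) (-1) 0 0 0, s3 0 0 0 0 0]
    have d2 : D 0 2 = D 2 0 := by linarith [s2 1 (-2) 0 0 0, s2 (-1) 2 0 0 0, s2 0 0 0 0 0]
    have d3 : D 1 2 = D 2 1 := by linarith [s1 (-2) 1 0 0 0, s1 2 (-1) 0 0 0, s1 0 0 0 0 0]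
    have t0 := tr 0 0 0 0 0
    have t1 := tr 1 0 0 0 0
    have t2 := tr (-1) 0 0 0 0
    have t3 := tr 0 1 0 0 0
    have t4 := tr 0 (-1) 0 0 0
    have t5 := tr 1 (-1) 0 0 0
    have t6 := tr (-1) 1 0 0 0
    have t7 := tr 0 0 1 1 0
    have t8 := tr 0 0 (-1) (-1) 0
    have t9 := tr 0 0 1 0 1
    have t10 := tr 0 0 (-1) 0 (-1)
    have t11 := tr 0 0 0 1 1
    have t12 := tr 0 0 0 (-1) (-1)
    have z0 : D 0 0 = 0 := by
      linear_combination (-1/4) * (t1 + t2) + (-1/4) * (t5 + t6) + (1/4) * (t3 + t4) + (1/2) * t0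
    have z1 : D 1 1 = 0 := by
      linear_combination (-1/2) * (t5 + t6 - 2 * t0) - z0
    have z2 : D 2 2 = 0 := by
      linear_combination (-1/2) * (t1 + t2 - 2 * t0) - z0
    have z5 : D 1 2 = 0 := by
      linear_combination (-1/4) * (t7 + t8 - 2 * t0) - z0 - (1/2) * z1 - (1/2) * z2 + (1/2) * d3
    have z4 : D 0 2 = 0 := by
      linear_combination (-1/4) * (t9 + t10 - 2 * t0) - (1/2) * z0 - z1 - (1/2) * z2 + (1/2) * d2
    have z3 : D 0 1 = 0 := by
      linear_combination (-1/4) * (t11 + t12 - 2 * t0) - (1/2) * z0 - (1/2) * z1 - z2 + (1/2) * d1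
    intro k b
    fin_cases k <;> fin_cases b <;> simp [z0, z1, z2, z3, z4, z5, ← d1, ← d2, ← d3]
  -- The conditions are now affine in the matrix entries, so first differences give the
  -- coefficients.
  simp only [d0, zero_mul, add_zero] at tr s1 s2 s3
  have t0 := tr 0 0 0 0 0
  have u0 := s1 0 0 0 0 0
  have v0 := s2 0 0 0 0 0
  have w0 := s3 0 0 0 0 0
  have b01 : B 0 1 = - C 1 0 := by linear_combination -(s3 0 1 0 0 0 - w0)
  have b10 : B 1 0 = - C 0 1 := by linear_combination s3 1 0 0 0 0 - w0
  have b02 : B 0 2 = - C 2 0 := by linear_combination -(s2 0 1 0 0 0 - v0)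
  have b20 : B 2 0 = - C 0 2 := by linear_combination s2 0 1 0 0 0 - s2 1 0 0 0 0
  have b12 : B 1 2 = - C 2 1 := by linear_combination s1 1 0 0 0 0 - u0
  have b21 : B 2 1 = - C 1 2 := by linear_combination s1 0 1 0 0 0 - s1 1 0 0 0 0
  have b11 : B 1 1 = B 0 0 + C 0 0 - C 1 1 := by linear_combination s3 0 0 1 0 0 - w0
  have b22 : B 2 2 = B 0 0 + C 0 0 - C 2 2 := by linear_combination -(s2 0 0 0 1 0 - v0)
  have c22 : C 2 2 = C 0 0 := by linear_combination (1/2) * (tr 1 0 0 0 0 - t0 + b22)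
  have c11 : C 1 1 = C 0 0 := by
    linear_combination (1/2) * (b11 - b22 - (tr 0 1 0 0 0 - t0)) + c22
  have c01 : C 0 1 = - C 1 0 := by linear_combination (1/2) * (b01 + b10 - (tr 0 0 1 0 0 - t0))
  have c02 : C 0 2 = - C 2 0 := by linear_combination (1/2) * (b02 + b20 - (tr 0 0 0 1 0 - t0))
  have c12 : C 1 2 = - C 2 1 := by linear_combination (1/2) * (b12 + b21 - (tr 0 0 0 0 1 - t0))
  refine ⟨d0, ?_, ?_, ?_⟩
  · intro a b
    fin_cases a <;> fin_cases b <;> simp [b01, b10, b02, b20, b12, b21, b11, b22]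
  · intro i j
    fin_cases i <;> fin_cases j <;> simp [c01, c02, c12, c11, c22] <;> ring
  · linear_combination t0 - τ * b11 - τ * b22 + 2 * τ * c11 + 2 * τ * c22

/-! ### Calculus of partial derivatives on `M` -/

/-- The derivative in the direction `v`. -/
noncomputable def dirD (v : R3 × R3) (f : R3 × R3 → ℝ) : R3 × R3 → ℝ := fun m => fderiv ℝ f m v

section DirD

variable {M : Set (R3 × R3)} {f g : R3 × R3 → ℝ} {m : R3 × R3}

theorem differentiableAt_of_smooth (hM : IsOpen M) (hf : ContDiffOn ℝ ∞ f M) (hm : m ∈ M) :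
    DifferentiableAt ℝ f m :=
  (hf.contDiffAt (hM.mem_nhds hm)).differentiableAt (by simp)

theorem contDiffOn_dirD (hM : IsOpen M) (hf : ContDiffOn ℝ ∞ f M) (v : R3 × R3) :
    ContDiffOn ℝ ∞ (dirD v f) M :=
  (hf.fderiv_of_isOpen hM (by simp)).clm_apply contDiffOn_const

theorem dirD_comm (hM : IsOpen M) (hf : ContDiffOn ℝ ∞ f M) (hm : m ∈ M) (v w : R3 × R3) :
    dirD v (dirD w f) m = dirD w (dirD v f) m := by
  have hf' : DifferentiableAt ℝ (fderiv ℝ f) m :=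
    ((hf.fderiv_of_isOpen (m := ∞) hM (by simp)).contDiffAt (hM.mem_nhds hm)).differentiableAt
      (by simp)
  have key : ∀ v w, dirD v (dirD w f) m = fderiv ℝ (fderiv ℝ f) m v w := fun v w => by
    unfold dirD
    rw [fderiv_clm_apply hf' (differentiableAt_const w)]
    simp
  rw [key, key]
  exact ((hf.contDiffAt (hM.mem_nhds hm)).isSymmSndFDerivAt (by
    rw [minSmoothness_of_isRCLikeNormedField]; exact WithTop.coe_le_coe.2 le_top)) v w

theorem dirD_congr (hM : IsOpen M) (h : Set.EqOn f g M) (v : R3 × R3) :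
    Set.EqOn (dirD v f) (dirD v g) M := fun m hm => by
  simp only [dirD, (h.eventuallyEq_of_mem (hM.mem_nhds hm)).fderiv_eq]

theorem dirD_eq_zero (hM : IsOpen M) (h : ∀ m ∈ M, f m = 0) (v : R3 × R3) (hm : m ∈ M) :
    dirD v f m = 0 := by
  rw [dirD_congr hM (g := fun _ => 0) h v hm]
  simp [dirD]

theorem dirD_add (hM : IsOpen M) (hf : ContDiffOn ℝ ∞ f M) (hg : ContDiffOn ℝ ∞ g M)
    (v : R3 × R3) (hm : m ∈ M) : dirD v (fun m => f m + g m) m = dirD v f m + dirD v g m := by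
  simp [dirD, fderiv_fun_add (differentiableAt_of_smooth hM hf hm)
    (differentiableAt_of_smooth hM hg hm)]

theorem dirD_sub (hM : IsOpen M) (hf : ContDiffOn ℝ ∞ f M) (hg : ContDiffOn ℝ ∞ g M)
    (v : R3 × R3) (hm : m ∈ M) : dirD v (fun m => f m - g m) m = dirD v f m - dirD v g m := by
  simp [dirD, fderiv_fun_sub (differentiableAt_of_smooth hM hf hm)
    (differentiableAt_of_smooth hM hg hm)]

theorem dirD_const_mul (hM : IsOpen M) (hf : ContDiffOn ℝ ∞ f M) (c : ℝ)
    (v : R3 × R3) (hm : m ∈ M) : dirD v (fun m => c * f m) m = c * dirD v f m := by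
  simp [dirD, fderiv_const_mul (differentiableAt_of_smooth hM hf hm)]

theorem hasDerivAt_line (hM : IsOpen M) (hf : ContDiffOn ℝ ∞ f M) (v : R3 × R3) (hm : m ∈ M) :
    HasDerivAt (fun t : ℝ => f (m + t • v)) (dirD v f m) 0 :=
  (differentiableAt_of_smooth hM hf hm).hasFDerivAt.hasLineDerivAt v

theorem dirD_eq_of_hasDerivAt (hM : IsOpen M) (hf : ContDiffOn ℝ ∞ f M) {v : R3 × R3} (hm : m ∈ M)
    {c : ℝ} (h : HasDerivAt (fun t : ℝ => f (m + t • v)) c 0) : dirD v f m = c :=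
  (hasDerivAt_line hM hf v hm).unique h

theorem eq_zero_of_dirD_eq_zero (hM : IsOpen M) (hM' : IsPreconnected M)
    (hf : ContDiffOn ℝ ∞ f M) (hx : ∀ m ∈ M, ∀ i, dirD (ex i) f m = 0)
    (hQ : ∀ m ∈ M, ∀ b, dirD (eQ b) f m = 0) {m₀ : R3 × R3} (hm₀ : m₀ ∈ M) (h0 : f m₀ = 0) :
    ∀ m ∈ M, f m = 0 := fun m hm => by
  rw [← h0]
  refine hM.is_const_of_fderiv_eq_zero (𝕜 := ℝ) hM'
    (hf.differentiableOn (by simp)) (fun m hm => ?_) hm hm₀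
  refine ContinuousLinearMap.ext fun v => ?_
  have : v = ∑ i, v.1 i • ex i + ∑ b, v.2 b • eQ b := by
    ext l <;> fin_cases l <;> simp [ex, eQ, Fin.sum_univ_three]
  have h1 := hx m hm
  have h2 := hQ m hm
  simp only [dirD] at h1 h2
  rw [this]
  simp [h1, h2]

end DirD

/-! ### Conformal Killing fields -/

/-- Fields `ξ` of the independent variables alone, satisfying the conformal Killing equation. -/
structure IsConformalKilling (M : Set (R3 × R3)) (ξ : Fin 3 → R3 × R3 → ℝ) : Prop where
  smooth : ∀ k, ContDiffOn ℝ ∞ (ξ k) M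
  dirD_eQ : ∀ m ∈ M, ∀ k b, dirD (eQ b) (ξ k) m = 0
  killing : ∀ m ∈ M, ∀ i j, dirD (ex j) (ξ i) m + dirD (ex i) (ξ j) m =
    if i = j then 2 * dirD (ex 0) (ξ 0) m else 0

/-- `H l j i` stands for `∂_l ∂_j ξ_i`. The alternating sum of the three permuted Killing equations
isolates one entry, exactly as Christoffel symbols are obtained from a metric. -/
theorem conformal_second_derivatives {H : Fin 3 → Fin 3 → Fin 3 → ℝ}
    (hs : ∀ l j i, H l j i = H j l i)
    (hk : ∀ l i j, H l j i + H l i j = if i = j then 2 * H l 0 0 else 0) (l j i : Fin 3) :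
    H l j i = (if i = j then H l 0 0 else 0) + (if i = l then H j 0 0 else 0)
      - if j = l then H i 0 0 else 0 := by
  have h1 := hk l i j
  have h2 := hk j i l
  have h3 := hk i j l
  have e1 := hs l j i
  have e2 := hs l i j
  have e3 := hs j i l
  split_ifs at * <;> linarith

/-- The hypothesis expresses that `∂_p` and `∂_l` commute on `∂_j ξ_i`, with `ν` the Hessian of `∂_0
ξ_0`. Dimension three enters here: a third index kills the off-diagonal entries, and three diagonal
entries that are pairwise opposite all vanish. -/
theorem conformal_third_derivatives {ν : Fin 3 → Fin 3 → ℝ}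
    (h : ∀ p l j i : Fin 3, (if i = j then ν p l else 0) + (if i = l then ν p j else 0)
      - (if j = l then ν p i else 0) = (if i = j then ν l p else 0) + (if i = p then ν l j else 0)
      - if j = p then ν l i else 0) (p l : Fin 3) : ν p l = 0 := by
  have a1 := h 1 0 1 0
  have a2 := h 2 0 2 0
  have a3 := h 2 1 2 1
  have b1 := h 1 0 2 0
  have b2 := h 2 0 1 0
  have b3 := h 0 1 2 1
  have b4 := h 2 1 0 1
  have b5 := h 0 2 1 2
  have b6 := h 1 2 0 2
  simp at a1 a2 a3 b1 b2 b3 b4 b5 b6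
  fin_cases p <;> fin_cases l <;> simp <;> linarith

namespace IsConformalKilling

variable {M : Set (R3 × R3)} {ξ η : Fin 3 → R3 × R3 → ℝ}

theorem sub (hM : IsOpen M) (hξ : IsConformalKilling M ξ) (hη : IsConformalKilling M η) :
    IsConformalKilling M fun k m => ξ k m - η k m where
  smooth k := (hξ.smooth k).sub (hη.smooth k)
  dirD_eQ m hm k b := by
    rw [dirD_sub hM (hξ.smooth k) (hη.smooth k) _ hm, hξ.dirD_eQ m hm, hη.dirD_eQ m hm, sub_zero]
  killing m hm i j := by
    simp only [fun i v => dirD_sub hM (hξ.smooth i) (hη.smooth i) v hm]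
    have h1 := hξ.killing m hm i j
    have h2 := hη.killing m hm i j
    split_ifs at * <;> linarith

theorem second (hM : IsOpen M) (hξ : IsConformalKilling M ξ) {m : R3 × R3} (hm : m ∈ M)
    (l j i : Fin 3) : dirD (ex l) (dirD (ex j) (ξ i)) m =
      (if i = j then dirD (ex l) (dirD (ex 0) (ξ 0)) m else 0)
      + (if i = l then dirD (ex j) (dirD (ex 0) (ξ 0)) m else 0)
      - if j = l then dirD (ex i) (dirD (ex 0) (ξ 0)) m else 0 := by
  have hs := fun i v => contDiffOn_dirD hM (hξ.smooth i) v
  refine conformal_second_derivatives (H := fun l j i => dirD (ex l) (dirD (ex j) (ξ i)) m)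
    (fun l j i => dirD_comm hM (hξ.smooth i) hm _ _) (fun l i j => ?_) l j i
  have h1 := dirD_congr hM (fun m hm => hξ.killing m hm i j) (ex l) hm
  rw [dirD_add hM (hs _ _) (hs _ _) _ hm] at h1
  rw [h1]
  split_ifs
  · exact dirD_const_mul hM (hs _ _) _ _ hm
  · simp [dirD]

theorem dirD_eQ_dirD (hM : IsOpen M) (hξ : IsConformalKilling M ξ) {m : R3 × R3} (hm : m ∈ M)
    (b k : Fin 3) (v : R3 × R3) : dirD (eQ b) (dirD v (ξ k)) m = 0 := by
  rw [dirD_comm hM (hξ.smooth k) hm]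
  exact dirD_eq_zero hM (fun m hm => hξ.dirD_eQ m hm k b) v hm

theorem third (hM : IsOpen M) (hξ : IsConformalKilling M ξ) {m : R3 × R3} (hm : m ∈ M)
    (p l : Fin 3) : dirD (ex p) (dirD (ex l) (dirD (ex 0) (ξ 0))) m = 0 := by
  have hs := fun i v => contDiffOn_dirD hM (hξ.smooth i) v
  have hs2 := fun l => contDiffOn_dirD hM (hs 0 (ex 0)) (ex l)
  have hc : ∀ (P : Prop) [Decidable P] (l : Fin 3), ContDiffOn ℝ ∞
      (fun m => if P then dirD (ex l) (dirD (ex 0) (ξ 0)) m else 0) M := fun P _ l => by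
    split_ifs
    · exact hs2 l
    · exact contDiffOn_const
  have hd : ∀ (P : Prop) [Decidable P] (p l : Fin 3), dirD (ex p)
      (fun m => if P then dirD (ex l) (dirD (ex 0) (ξ 0)) m else 0) m
      = if P then dirD (ex p) (dirD (ex l) (dirD (ex 0) (ξ 0))) m else 0 := fun P _ p l => by
    split_ifs
    · rfl
    · simp [dirD]
  refine conformal_third_derivatives
    (ν := fun p l => dirD (ex p) (dirD (ex l) (dirD (ex 0) (ξ 0))) m) (fun p l j i => ?_) p l
  have key : ∀ p l, dirD (ex p) (dirD (ex l) (dirD (ex j) (ξ i))) m = _ := fun p l =>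
    dirD_congr hM (fun m hm => hξ.second hM hm l j i) (ex p) hm
  have key' := key p l
  rw [dirD_comm hM (hs i (ex j)) hm, key,
    dirD_sub hM ((hc _ _).add (hc _ _)) (hc _ _) _ hm, dirD_add hM (hc _ _) (hc _ _) _ hm,
    dirD_sub hM ((hc _ _).add (hc _ _)) (hc _ _) _ hm, dirD_add hM (hc _ _) (hc _ _) _ hm] at key'
  simp only [hd] at key'
  exact key'.symm

/-- A conformal Killing field whose 2-jet vanishes at one point is zero. -/
theorem eq_zero (hM : IsOpen M) (hM' : IsPreconnected M) (hξ : IsConformalKilling M ξ)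
    {m₀ : R3 × R3} (hm₀ : m₀ ∈ M) (h0 : ∀ k, ξ k m₀ = 0)
    (h1 : ∀ j k, dirD (ex j) (ξ k) m₀ = 0)
    (h2 : ∀ l, dirD (ex l) (dirD (ex 0) (ξ 0)) m₀ = 0) : ∀ k, ∀ m ∈ M, ξ k m = 0 := by
  have hs := fun i v => contDiffOn_dirD hM (hξ.smooth i) v
  -- Integration from the top: the derivatives of `∂_0 ξ_0` are constant, they determine all second
  -- derivatives, and vanishing second derivatives make the first ones constant.
  have hμ : ∀ l, ∀ m ∈ M, dirD (ex l) (dirD (ex 0) (ξ 0)) m = 0 := fun l =>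
    eq_zero_of_dirD_eq_zero hM hM' (contDiffOn_dirD hM (hs _ _) _)
      (fun m hm i => hξ.third hM hm i l)
      (fun m hm b => by
        rw [dirD_comm hM (hs _ _) hm]
        exact dirD_eq_zero hM (fun m hm => hξ.dirD_eQ_dirD hM hm b 0 _) _ hm) hm₀ (h2 l)
  have hC : ∀ j k, ∀ m ∈ M, dirD (ex j) (ξ k) m = 0 := fun j k =>
    eq_zero_of_dirD_eq_zero hM hM' (hs _ _)
      (fun m hm i => by rw [hξ.second hM hm]; simp [hμ _ m hm])
      (fun m hm b => hξ.dirD_eQ_dirD hM hm b k _) hm₀ (h1 j k)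
  exact fun k => eq_zero_of_dirD_eq_zero hM hM' (hξ.smooth k) (fun m hm i => hC i k m hm)
    (fun m hm b => hξ.dirD_eQ m hm k b) hm₀ (h0 k)

end IsConformalKilling

theorem dirD_ex_genField_fst (a : Fin 10 → ℝ) (j k : Fin 3) (m : R3 × R3) :
    dirD (ex j) (fun m => (genField a m).1 k) m = genMatrix a m.1 k j := by
  simp [dirD, fderiv_genField_fst, ex, Pi.single_apply]

theorem dirD_ex_dirD_ex_genField_fst (a : Fin 10 → ℝ) (l j k : Fin 3) (m : R3 × R3) :
    dirD (ex l) (dirD (ex j) fun m => (genField a m).1 k) m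
      = genMatrix a (Pi.single l 1) k j - genMatrix a 0 k j := by
  have : (dirD (ex j) fun m => (genField a m).1 k) = fun m => genMatrix a m.1 k j :=
    funext fun m => dirD_ex_genField_fst a j k m
  rw [this]
  refine fderiv_apply_eq_of_quadratic _ 0 ?_ fun s => ?_
  · fin_cases k <;> fin_cases j <;> simp [genMatrix] <;> fun_prop
  · fin_cases k <;> fin_cases j <;> simp [genMatrix, ex] <;> ring

theorem isConformalKilling_genField (M : Set (R3 × R3)) (a : Fin 10 → ℝ) :
    IsConformalKilling M fun k m => (genField a m).1 k where
  smooth k := (contDiff_pi.1 (contDiff_genField a).fst k).contDiffOn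
  dirD_eQ m _ k b := by simp [dirD, fderiv_genField_fst, eQ]
  killing m _ i j := by
    simp only [dirD_ex_genField_fst]
    fin_cases i <;> fin_cases j <;> simp [genMatrix] <;> ring

/-- The conformal Killing fields are the spatial parts of the ten-parameter fields. -/
theorem IsConformalKilling.exists_eq {M : Set (R3 × R3)} {ξ : Fin 3 → R3 × R3 → ℝ}
    (hM : IsOpen M) (hM' : IsConnected M) (hξ : IsConformalKilling M ξ) :
    ∃ a, ∀ k, ∀ m ∈ M, ξ k m = (genField a m).1 k := by
  obtain ⟨m₀, hm₀⟩ := hM'.nonempty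
  obtain ⟨μ, hμ⟩ : ∃ μ : R3, ∀ l, μ l = dirD (ex l) (dirD (ex 0) (ξ 0)) m₀ / 2 := ⟨_, fun _ => rfl⟩
  obtain ⟨C, hC⟩ : ∃ C : Fin 3 → R3, ∀ k j, C k j = dirD (ex j) (ξ k) m₀ := ⟨_, fun _ _ => rfl⟩
  have hC' : ∀ i j, C i j + C j i = if i = j then 2 * C 0 0 else 0 := fun i j => by
    simp only [hC]; exact hξ.killing m₀ hm₀ i j
  -- `b` matches the first and second derivatives of `ξ` at `m₀`; the translations, set to zero
  -- here, are then used in `a` to match the values.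
  obtain ⟨b, hb⟩ : ∃ b : Fin 10 → ℝ, b = ![μ 0, μ 1, μ 2,
    C 2 0 - 2 * μ 0 * m₀.1 2 + 2 * μ 2 * m₀.1 0,
    C 0 0 - 2 * (μ 0 * m₀.1 0 + μ 1 * m₀.1 1 + μ 2 * m₀.1 2),
    C 1 0 - 2 * μ 0 * m₀.1 1 + 2 * μ 1 * m₀.1 0,
    C 2 1 - 2 * μ 1 * m₀.1 2 + 2 * μ 2 * m₀.1 1, 0, 0, 0] := ⟨_, rfl⟩
  obtain ⟨a, ha⟩ : ∃ a : Fin 10 → ℝ, a = ![b 0, b 1, b 2, b 3, b 4, b 5, b 6,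
    ξ 2 m₀ - (genField b m₀).1 2, ξ 0 m₀ - (genField b m₀).1 0,
    ξ 1 m₀ - (genField b m₀).1 1] := ⟨_, rfl⟩
  refine ⟨a, fun k m hm => sub_eq_zero.1 ?_⟩
  have hg := isConformalKilling_genField M a
  have hd := hξ.sub hM hg
  refine hd.eq_zero hM hM'.isPreconnected hm₀ (fun k => ?_) (fun j k => ?_) (fun l => ?_) k m hm
  · fin_cases k <;> simp [ha, hb, genField]
  · rw [dirD_sub hM (hξ.smooth k) (hg.smooth k) _ hm₀, dirD_ex_genField_fst, ← hC]
    have h1 := hC' 0 1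
    have h2 := hC' 0 2
    have h3 := hC' 1 2
    have h4 := hC' 1 1
    have h5 := hC' 2 2
    simp at h1 h2 h3 h4 h5
    fin_cases j <;> fin_cases k <;> simp [ha, hb, genMatrix] <;> linarith
  · rw [dirD_congr hM (fun m hm => dirD_sub hM (hξ.smooth 0) (hg.smooth 0) _ hm) _ hm₀,
      dirD_sub hM (contDiffOn_dirD hM (hξ.smooth 0) _) (contDiffOn_dirD hM (hg.smooth 0) _) _ hm₀,
      dirD_ex_dirD_ex_genField_fst]
    have := hμ l
    fin_cases l <;> simp [ha, hb, genMatrix] at this ⊢ <;> linarith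

/-! ### Determining equations and classification of the generators -/

theorem determining_equations {Ω : Set R3} (hΩ : IsOpen Ω) {q : R3 → ℝ}
    (hq : ContDiffOn ℝ 1 q Ω) {M : Set (R3 × R3)} (hM : M ⊆ Ω ×ˢ Set.univ) {X : VField}
    (hX : IsLieSymmetry q M X) {m : R3 × R3} (hm : m ∈ M) {ξ φ : Fin 3 → R3 × R3 → ℝ}
    (hξ : ∀ k m, ξ k m = (X m).1 k) (hφ : ∀ k m, φ k m = (X m).2 k) :
    (∀ k b, dirD (eQ b) (ξ k) m = 0) ∧
    (∀ a b, dirD (eQ b) (φ a) m =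
      (if a = b then dirD (eQ 0) (φ 0) m + dirD (ex 0) (ξ 0) m else 0) - dirD (ex a) (ξ b) m) ∧
    (∀ i j, dirD (ex j) (ξ i) m + dirD (ex i) (ξ j) m =
      if i = j then 2 * dirD (ex 0) (ξ 0) m else 0) ∧
    dirD (ex 0) (φ 0) m + dirD (ex 1) (φ 1) m + dirD (ex 2) (φ 2) m
      + (m.2 0 ^ 2 + m.2 1 ^ 2 + m.2 2 ^ 2 - q m.1)
        * (dirD (eQ 0) (φ 0) m + dirD (ex 0) (ξ 0) m - 2 * dirD (ex 0) (ξ 0) m)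
      = 2 * (m.2 0 * φ 0 m + m.2 1 * φ 1 m + m.2 2 * φ 2 m)
        - (ξ 0 m * pd 0 q m.1 + ξ 1 m * pd 1 q m.1 + ξ 2 m * pd 2 q m.1) := by
  have hq' : DifferentiableAt ℝ q m.1 :=
    (hq.contDiffAt (hΩ.mem_nhds (hM hm).1)).differentiableAt one_ne_zero
  obtain rfl : ξ = fun k m => (X m).1 k := by ext; simp [hξ]
  obtain rfl : φ = fun k m => (X m).2 k := by ext; simp [hφ]
  -- With `m` fixed, the partial derivatives of `X` are constants and only the jet `P` varies, over
  -- all symmetric matrices of trace `|Q|² - q`.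
  refine determining_algebra (A := fun a i => dirD (ex i) (fun m => (X m).2 a) m)
    (B := fun a b => dirD (eQ b) (fun m => (X m).2 a) m)
    (C := fun k i => dirD (ex i) (fun m => (X m).1 k) m)
    (D := fun k b => dirD (eQ b) (fun m => (X m).1 k) m)
    (W := fun P a i => prolongCoeff X (m.1, m.2, P) a i)
    (fun P a i => ?_) (fun P hP hP' => ?_)
  · simp only [prolongCoeff, totalDeriv_eq, dirD]
  · have h1 := hX.2 (m.1, m.2, P) hm (riccati_eq_zero_iff.2 ⟨hP, hP'⟩)
    obtain ⟨h2, h3⟩ := (prolong_riccati_eq_zero_iff (j := (m.1, m.2, P)) hq').1 h1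
    refine ⟨?_, h3⟩
    rw [fderiv_eq_sum_pd] at h2
    linarith

theorem hasDerivAt_snd_line (m : R3 × R3) (b a : Fin 3) :
    HasDerivAt (fun t : ℝ => (m + t • eQ b).2 a) (if a = b then 1 else 0) 0 := by
  have h : HasDerivAt (fun t : ℝ => m.2 a + t * if a = b then 1 else 0) (if a = b then 1 else 0) 0 := by
    simpa using ((hasDerivAt_id (0 : ℝ)).mul_const (if a = b then (1 : ℝ) else 0)).const_add (m.2 a)
  refine h.congr_of_eventuallyEq (.of_forall fun t => ?_)
  simp [eQ, Pi.single_apply]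

/-- Every symmetry generator is a ten-parameter field. -/
theorem IsLieSymmetry.exists_eq_genField {Ω : Set R3} (hΩ : IsOpen Ω) {q : R3 → ℝ}
    (hq : ContDiffOn ℝ 1 q Ω) {M : Set (R3 × R3)} (hMo : IsOpen M) (hMc : IsConnected M)
    (hM : M ⊆ Ω ×ˢ Set.univ) {X : VField} (hX : IsLieSymmetry q M X) :
    ∃ a, ∀ m ∈ M, X m = genField a m := by
  obtain ⟨ξ, hξ⟩ : ∃ ξ : Fin 3 → R3 × R3 → ℝ, ∀ k m, ξ k m = (X m).1 k := ⟨_, fun _ _ => rfl⟩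
  obtain ⟨φ, hφ⟩ : ∃ φ : Fin 3 → R3 × R3 → ℝ, ∀ k m, φ k m = (X m).2 k := ⟨_, fun _ _ => rfl⟩
  have hξs : ∀ k, ContDiffOn ℝ ∞ (ξ k) M := fun k => by
    have := contDiffOn_pi.1 hX.1.fst k
    exact this.congr fun m _ => hξ k m
  have hφs : ∀ k, ContDiffOn ℝ ∞ (φ k) M := fun k => by
    have := contDiffOn_pi.1 hX.1.snd k
    exact this.congr fun m _ => hφ k m
  have det := fun m (hm : m ∈ M) => determining_equations hΩ hq hM hX hm hξ hφ
  have conf : IsConformalKilling M ξ :=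
    ⟨hξs, fun m hm => (det m hm).1, fun m hm => (det m hm).2.2.1⟩
  obtain ⟨a, ha⟩ := conf.exists_eq hMo hMc
  obtain ⟨μ, hμ⟩ : ∃ μ, μ = dirD (ex 0) (ξ 0) := ⟨_, rfl⟩
  obtain ⟨σ, hσ⟩ : ∃ σ : R3 × R3 → ℝ, ∀ m, σ m = dirD (eQ 0) (φ 0) m + μ m := ⟨_, fun _ => rfl⟩
  have dφs := fun k v => contDiffOn_dirD hMo (hφs k) v
  have dξs := fun k v => contDiffOn_dirD hMo (hξs k) v
  have μs : ContDiffOn ℝ ∞ μ M := hμ ▸ dξs 0 (ex 0)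
  have σs : ContDiffOn ℝ ∞ σ M := ((dφs 0 (eQ 0)).add μs).congr fun m _ => hσ m
  have hB : ∀ m ∈ M, ∀ a b, dirD (eQ b) (φ a) m = (if a = b then σ m else 0)
      - dirD (ex a) (ξ b) m := fun m hm a b => by rw [(det m hm).2.1, hσ, hμ]
  have hμQ : ∀ m ∈ M, ∀ b, dirD (eQ b) μ m = 0 := fun m hm b => by
    rw [hμ]; exact conf.dirD_eQ_dirD hMo hm b 0 _
  -- For `a ≠ b`, the derivative of `φ a` in `Q_a` and `Q_b` equals `∂σ/∂Q_b` in one order and,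
  -- since `ξ` is free of `Q`, zero in the other.
  have hσQ : ∀ m ∈ M, ∀ b, dirD (eQ b) σ m = 0 := by
    intro m hm b
    obtain ⟨a, hab⟩ : ∃ a : Fin 3, a ≠ b := exists_ne b
    have h1 := dirD_congr hMo (fun m hm => hB m hm a a) (eQ b) hm
    have h2 := dirD_congr hMo (fun m hm => hB m hm a b) (eQ a) hm
    simp only [if_true] at h1
    simp only [hab, if_false] at h2
    rw [dirD_sub hMo σs (dξs _ _) _ hm, conf.dirD_eQ_dirD hMo hm, sub_zero] at h1
    rw [← h1, dirD_comm hMo (hφs a) hm, h2, dirD_sub hMo contDiffOn_const (dξs _ _) _ hm,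
      conf.dirD_eQ_dirD hMo hm]
    simp [dirD]
  -- `Ψ` collects the terms of the scalar equation without `q`. It is smooth, and on `M` it equals
  -- `q (σ - 2μ) - ξ · ∇q`.
  obtain ⟨Ψ, hΨ⟩ : ∃ Ψ : R3 × R3 → ℝ, ∀ m, Ψ m = dirD (ex 0) (φ 0) m + dirD (ex 1) (φ 1) m
      + dirD (ex 2) (φ 2) m + (m.2 0 ^ 2 + m.2 1 ^ 2 + m.2 2 ^ 2) * (σ m - 2 * μ m)
      - 2 * (m.2 0 * φ 0 m + m.2 1 * φ 1 m + m.2 2 * φ 2 m) := ⟨_, fun _ => rfl⟩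
  have Qs : ∀ k, ContDiffOn ℝ ∞ (fun m : R3 × R3 => m.2 k) M := fun k =>
    (contDiff_pi.1 contDiff_snd k).contDiffOn
  have Ψs : ContDiffOn ℝ ∞ Ψ M := by
    refine ContDiffOn.congr ?_ fun m _ => hΨ m
    exact ((((dφs _ _).add (dφs _ _)).add (dφs _ _)).add
      (((((Qs 0).pow 2).add ((Qs 1).pow 2)).add ((Qs 2).pow 2)).mul
        (σs.sub (contDiffOn_const.mul μs)))).sub (contDiffOn_const.mul
      ((((Qs 0).mul (hφs 0)).add ((Qs 1).mul (hφs 1))).add ((Qs 2).mul (hφs 2))))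
  have hΨ0 : ∀ m ∈ M, ∀ b, dirD (eQ b) Ψ m = 0 := by
    intro m hm b
    refine dirD_eq_of_hasDerivAt hMo Ψs hm ?_
    -- Only `Q` moves, so `q` and its gradient stay frozen at `m.1` and need not be differentiated.
    have h1 : HasDerivAt (fun t : ℝ => q m.1 * (σ (m + t • eQ b) - 2 * μ (m + t • eQ b))
        - (ξ 0 (m + t • eQ b) * pd 0 q m.1 + ξ 1 (m + t • eQ b) * pd 1 q m.1
          + ξ 2 (m + t • eQ b) * pd 2 q m.1)) 0 0 := by
      have := (((hasDerivAt_line hMo σs (eQ b) hm).sub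
        ((hasDerivAt_line hMo μs (eQ b) hm).const_mul 2)).const_mul (q m.1)).sub
        ((((hasDerivAt_line hMo (hξs 0) (eQ b) hm).mul_const (pd 0 q m.1)).add
        ((hasDerivAt_line hMo (hξs 1) (eQ b) hm).mul_const (pd 1 q m.1))).add
        ((hasDerivAt_line hMo (hξs 2) (eQ b) hm).mul_const (pd 2 q m.1)))
      exact this.congr_deriv (by simp [hσQ m hm, hμQ m hm, conf.dirD_eQ m hm])
    refine h1.congr_of_eventuallyEq ?_
    have hc : ContinuousAt (fun t : ℝ => m + t • eQ b) 0 := by fun_prop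
    have : ∀ᶠ t : ℝ in 𝓝 0, m + t • eQ b ∈ M :=
      hc.eventually_mem (hMo.mem_nhds (by simpa using hm))
    filter_upwards [this] with t ht
    have h2 := (det _ ht).2.2.2
    have h3 : (m + t • eQ b).1 = m.1 := by simp [eQ]
    rw [← hμ, ← hσ, h3] at h2
    rw [hΨ]
    linarith
  -- This is `∂Ψ/∂Q_b = 0` written out; the term `-2 φ b` makes it a formula for `φ b`.
  have hΨ1 : ∀ m ∈ M, ∀ b, dirD (ex b) σ m - (dirD (ex 0) (dirD (ex 0) (ξ b)) m
      + dirD (ex 1) (dirD (ex 1) (ξ b)) m + dirD (ex 2) (dirD (ex 2) (ξ b)) m)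
      + 2 * m.2 b * (σ m - 2 * μ m) - 2 * φ b m - 2 * m.2 b * σ m
      + 2 * (m.2 0 * dirD (ex 0) (ξ b) m + m.2 1 * dirD (ex 1) (ξ b) m
        + m.2 2 * dirD (ex 2) (ξ b) m) = 0 := by
    intro m hm b
    rw [← hΨ0 m hm b]
    refine (dirD_eq_of_hasDerivAt hMo Ψs hm ?_).symm
    have hL := fun f (hf : ContDiffOn ℝ ∞ f M) => hasDerivAt_line hMo hf (eQ b) hm
    have hQ := hasDerivAt_snd_line m b
    have h1 := ((((hL _ (dφs 0 (ex 0))).add (hL _ (dφs 1 (ex 1)))).add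
      (hL _ (dφs 2 (ex 2)))).add
      (((((hQ 0).pow 2).add ((hQ 1).pow 2)).add ((hQ 2).pow 2)).mul
        ((hL _ σs).sub ((hL _ μs).const_mul 2)))).sub (HasDerivAt.const_mul 2
      ((((hQ 0).mul (hL _ (hφs 0))).add ((hQ 1).mul (hL _ (hφs 1)))).add
        ((hQ 2).mul (hL _ (hφs 2)))))
    have h2 : ∀ a, dirD (eQ b) (dirD (ex a) (φ a)) m = (if a = b then dirD (ex a) σ m else 0)
        - dirD (ex a) (dirD (ex a) (ξ b)) m := fun a => by
      rw [dirD_comm hMo (hφs a) hm, dirD_congr hMo (fun m hm => hB m hm a b) _ hm]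
      split_ifs with h
      · exact dirD_sub hMo σs (dξs _ _) _ hm
      · rw [dirD_sub hMo contDiffOn_const (dξs _ _) _ hm]
        simp [dirD]
    refine (h1.congr_deriv ?_).congr_of_eventuallyEq (.of_forall fun t => hΨ _)
    simp only [h2, hσQ m hm, hμQ m hm, hB m hm, zero_smul, add_zero, Pi.add_apply, Pi.sub_apply,
      Pi.pow_apply]
    fin_cases b <;> simp <;> ring
  -- A further derivative of the formula for `φ 0`, now in `Q_0`, gives `2(σ - 2μ) - 2(σ - μ) - 2σ +
  -- 2μ = 0`, that is `-2σ = 0`.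
  have hσ0 : ∀ m ∈ M, σ m = 0 := by
    intro m hm
    have hL := fun f (hf : ContDiffOn ℝ ∞ f M) => hasDerivAt_line hMo hf (eQ 0) hm
    have hQ := hasDerivAt_snd_line m 0
    have h1 := ((((hL _ (contDiffOn_dirD hMo σs (ex 0))).sub
      (((hL _ (contDiffOn_dirD hMo (dξs 0 (ex 0)) (ex 0))).add
        (hL _ (contDiffOn_dirD hMo (dξs 0 (ex 1)) (ex 1)))).add
        (hL _ (contDiffOn_dirD hMo (dξs 0 (ex 2)) (ex 2))))).add
      (((hQ 0).const_mul 2).mul ((hL _ σs).sub ((hL _ μs).const_mul 2)))).sub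
      ((hL _ (hφs 0)).const_mul 2)).sub (((hQ 0).const_mul 2).mul (hL _ σs)) |>.add
      (HasDerivAt.const_mul 2 ((((hQ 0).mul (hL _ (dξs 0 (ex 0)))).add
        ((hQ 1).mul (hL _ (dξs 0 (ex 1))))).add ((hQ 2).mul (hL _ (dξs 0 (ex 2))))))
    have hc : ContinuousAt (fun t : ℝ => m + t • eQ 0) 0 := by fun_prop
    have : ∀ᶠ t : ℝ in 𝓝 0, m + t • eQ 0 ∈ M :=
      hc.eventually_mem (hMo.mem_nhds (by simpa using hm))
    have h2 := h1.unique ((hasDerivAt_const (0 : ℝ) (0 : ℝ)).congr_of_eventuallyEq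
      (this.mono fun t ht => hΨ1 _ ht 0))
    have h3 : dirD (eQ 0) (dirD (ex 0) σ) m = 0 := by
      rw [dirD_comm hMo σs hm]
      exact dirD_eq_zero hMo (fun m hm => hσQ m hm 0) _ hm
    have h4 : ∀ i, dirD (eQ 0) (dirD (ex i) (dirD (ex i) (ξ 0))) m = 0 := fun i => by
      rw [dirD_comm hMo (dξs _ _) hm]
      exact dirD_eq_zero hMo (fun m hm => conf.dirD_eQ_dirD hMo hm 0 0 _) _ hm
    simp only [h3, h4, hσQ m hm, hμQ m hm, hB m hm, conf.dirD_eQ_dirD hMo hm, zero_smul,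
      add_zero] at h2
    rw [← hμ] at h2
    simp at h2
    linarith
  refine ⟨a, fun m hm => Prod.ext (funext fun k => (hξ k m).symm.trans (ha k m hm))
    (funext fun b => ?_)⟩
  have h1 := hΨ1 m hm b
  have h2 : dirD (ex b) σ m = 0 := dirD_eq_zero hMo hσ0 _ hm
  have h3 : ∀ j k, dirD (ex j) (ξ k) m = genMatrix a m.1 k j := fun j k => by
    rw [dirD_congr hMo (fun m hm => ha k m hm) _ hm, dirD_ex_genField_fst]
  have h4 : ∀ l j k, dirD (ex l) (dirD (ex j) (ξ k)) m
      = genMatrix a (Pi.single l 1) k j - genMatrix a 0 k j := fun l j k => by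
    rw [dirD_congr hMo (dirD_congr hMo (fun m hm => ha k m hm) _) _ hm,
      dirD_ex_dirD_ex_genField_fst]
  rw [h2, hσ0 m hm, hμ] at h1
  simp only [h3, h4, hφ] at h1
  fin_cases b <;> simp [genMatrix, genField] at h1 ⊢ <;> linarith

/-- The parameters of a ten-parameter field are determined by its values on an open set. -/
theorem genField_injOn {M : Set (R3 × R3)} (hMo : IsOpen M) (hMn : M.Nonempty)
    {a b : Fin 10 → ℝ} (h : ∀ m ∈ M, genField a m = genField b m) : a = b := by
  obtain ⟨m, hm⟩ := hMn
  have h0 : ∀ m ∈ M, ∀ k, (genField a m).1 k = (genField b m).1 k := fun m hm k => by rw [h m hm]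
  have h1 : ∀ m ∈ M, ∀ k j, genMatrix a m.1 k j = genMatrix b m.1 k j := fun m hm k j => by
    rw [← dirD_ex_genField_fst, ← dirD_ex_genField_fst]
    exact dirD_congr hMo (fun m hm => h0 m hm k) _ hm
  have h2 : ∀ l k j, genMatrix a (Pi.single l 1) k j - genMatrix a 0 k j
      = genMatrix b (Pi.single l 1) k j - genMatrix b 0 k j := fun l k j => by
    rw [← dirD_ex_dirD_ex_genField_fst a l j k m, ← dirD_ex_dirD_ex_genField_fst b l j k m]
    exact dirD_congr hMo (dirD_congr hMo (fun m hm => h0 m hm k) _) _ hm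
  have e0 : a 0 = b 0 := by simpa [genMatrix] using h2 0 0 0
  have e1 : a 1 = b 1 := by simpa [genMatrix] using h2 1 0 0
  have e2 : a 2 = b 2 := by simpa [genMatrix] using h2 2 0 0
  have e3 : a 3 = b 3 := by simpa [genMatrix, e0, e1, e2] using h1 m hm 2 0
  have e4 : a 4 = b 4 := by simpa [genMatrix, e0, e1, e2] using h1 m hm 0 0
  have e5 : a 5 = b 5 := by simpa [genMatrix, e0, e1, e2] using h1 m hm 1 0
  have e6 : a 6 = b 6 := by simpa [genMatrix, e0, e1, e2] using h1 m hm 2 1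
  have e7 : a 7 = b 7 := by simpa [genField, e0, e1, e2, e3, e4, e5, e6] using h0 m hm 2
  have e8 : a 8 = b 8 := by simpa [genField, e0, e1, e2, e3, e4, e5, e6] using h0 m hm 0
  have e9 : a 9 = b 9 := by simpa [genField, e0, e1, e2, e3, e4, e5, e6] using h0 m hm 1
  ext i
  fin_cases i <;> assumption

/-- The classification of the symmetry generators. -/
theorem isLieSymmetry_iff_existsUnique {Ω : Set R3} (hΩ : IsOpen Ω) {q : R3 → ℝ}
    (hq : ContDiffOn ℝ 1 q Ω) {M : Set (R3 × R3)} (hMo : IsOpen M) (hMc : IsConnected M)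
    (hM : M ⊆ Ω ×ˢ Set.univ) (X : VField) :
    IsLieSymmetry q M X ↔
      ∃! a : Fin 10 → ℝ, (∀ m ∈ M, X m = genField a m) ∧ ∀ p ∈ Prod.fst '' M, CondQ a q p := by
  constructor
  · intro hX
    obtain ⟨a, ha⟩ := hX.exists_eq_genField hΩ hq hMo hMc hM
    refine ⟨a, ⟨ha, ?_⟩, fun b hb => genField_injOn hMo hMc.nonempty fun m hm => ?_⟩
    · exact (isLieSymmetry_genField_iff hΩ hq hM a).1 ((isLieSymmetry_congr hMo ha).1 hX)
    · rw [← ha m hm, hb.1 m hm]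
  · rintro ⟨a, ⟨ha, hc⟩, -⟩
    exact (isLieSymmetry_congr hMo ha).2 ((isLieSymmetry_genField_iff hΩ hq hM a).2 hc)

/-! ### The ten fields and their flows -/

/-- The parameters of the fields of the table. -/
def tableParam (k : Fin 10) : Fin 10 → ℝ :=
  ![Pi.single 8 1, Pi.single 9 1, Pi.single 7 1, Pi.single 6 1, -Pi.single 3 1, Pi.single 5 1,
    Pi.single 4 1, Pi.single 0 1, Pi.single 1 1, Pi.single 2 1] k

theorem tableField_eq_genField (k : Fin 10) : tableField k = genField (tableParam k) := by
  funext m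
  rw [genField_eq_sum]
  fin_cases k <;> simp [tableParam]

/-- The infinitesimal scaling factor of the fields of the table. -/
def tableRate (k : Fin 10) (p : R3) : ℝ :=
  ![0, 0, 0, 0, 0, 0, 1, 2 * p 0, 2 * p 1, 2 * p 2] k

theorem condQ_tableParam_iff (k : Fin 10) (q : R3 → ℝ) (m : R3 × R3) :
    CondQ (tableParam k) q m.1 ↔
      fderiv ℝ q m.1 (tableField k m).1 + 2 * tableRate k m.1 * q m.1 = 0 := by
  rw [condQ_iff, tableField_eq_genField]
  fin_cases k <;> simp [tableParam, tableRate]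

/-- The factor by which the `k`-th group multiplies the potential. -/
noncomputable def groupWeight (k : Fin 10) (t : ℝ) (p : R3) : ℝ :=
  ![1, 1, 1, 1, 1, 1, Real.exp (-(2 * t)),
    alpha (p 0) (rsq p) t ^ 2, alpha (p 1) (rsq p) t ^ 2, alpha (p 2) (rsq p) t ^ 2] k

theorem groupX_zero (k : Fin 10) (p : R3) : groupX k 0 p = p := by
  ext l
  fin_cases k <;> fin_cases l <;> simp [groupX, groupDen, alpha]

theorem groupQ_zero (k : Fin 10) (p Q : R3) : groupQ k 0 p Q = Q := by
  ext l
  fin_cases k <;> fin_cases l <;> simp [groupQ, groupDen, alpha]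

theorem groupDen_zero (k : Fin 10) (p : R3) : groupDen k 0 p = 1 := by
  fin_cases k <;> simp [groupDen, alpha]

theorem groupWeight_zero (k : Fin 10) (p : R3) : groupWeight k 0 p = 1 := by
  fin_cases k <;> simp [groupWeight, alpha]

theorem groupWeight_ne_zero {k : Fin 10} {t : ℝ} {p : R3} (h : groupDen k t p ≠ 0) :
    groupWeight k t p ≠ 0 := by
  fin_cases k <;> simp [groupWeight, groupDen] at h ⊢ <;> exact h

theorem hasDerivAt_quadratic (c₀ c₁ c₂ t : ℝ) :
    HasDerivAt (fun s : ℝ => c₀ + c₁ * s + c₂ * s ^ 2) (c₁ + 2 * c₂ * t) t := by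
  have := (((hasDerivAt_id t).const_mul c₁).const_add c₀).add
    (((hasDerivAt_id t).pow 2).const_mul c₂)
  exact (this.congr_deriv (by simp; ring)).congr_of_eventuallyEq (.of_forall fun s => by simp)

theorem hasDerivAt_of_quadratic {f : ℝ → ℝ} {t d : ℝ} (c₀ c₁ c₂ : ℝ)
    (hf : ∀ s, f s = c₀ + c₁ * s + c₂ * s ^ 2) (hd : d = c₁ + 2 * c₂ * t) : HasDerivAt f d t := by
  rw [hd, funext hf]
  exact hasDerivAt_quadratic c₀ c₁ c₂ t

/-- Every coordinate of a conical orbit is a linear function of the parameter over `alpha`. The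
derivative is prescribed with denominators cleared. -/
theorem hasDerivAt_of_linear_div_alpha {f : ℝ → ℝ} {s r2 t d : ℝ} (A B : ℝ)
    (ht : alpha s r2 t ≠ 0) (hf : ∀ l, f l = (A + B * l) / alpha s r2 l)
    (hd : d * alpha s r2 t ^ 2 = B * alpha s r2 t - (A + B * t) * (2 * r2 * t - 2 * s)) :
    HasDerivAt f d t := by
  have h1 : HasDerivAt (fun l => alpha s r2 l) (2 * r2 * t - 2 * s) t :=
    hasDerivAt_of_quadratic 1 (-2 * s) r2 (fun l => by simp [alpha]; ring) (by ring)
  have h2 : HasDerivAt (fun l => A + B * l) B t :=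
    hasDerivAt_of_quadratic A B 0 (fun l => by ring) (by ring)
  have h3 := h2.div h1 ht
  rw [← hd, mul_div_cancel_right₀ _ (pow_ne_zero 2 ht)] at h3
  exact h3.congr_of_eventuallyEq (.of_forall hf)

/-- This is the linear differential equation which `CondQ` imposes on `q` along an orbit. -/
theorem hasDerivAt_groupWeight {k : Fin 10} {t : ℝ} {p : R3} (h : groupDen k t p ≠ 0) :
    HasDerivAt (fun s => groupWeight k s p)
      (-(2 * tableRate k (groupX k t p) * groupWeight k t p)) t := by
  have hα : ∀ i, HasDerivAt (fun l => alpha (p i) (rsq p) l ^ 2)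
      (2 * alpha (p i) (rsq p) t * (2 * rsq p * t - 2 * p i)) t := fun i => by
    have h1 : HasDerivAt (fun l => alpha (p i) (rsq p) l) (2 * rsq p * t - 2 * p i) t :=
      hasDerivAt_of_quadratic 1 (-2 * p i) (rsq p) (fun l => by simp [alpha]; ring) (by ring)
    exact (h1.pow 2).congr_deriv (by simp)
  fin_cases k <;> simp [groupWeight, tableRate, groupX, groupDen] at h ⊢
  iterate 6 exact hasDerivAt_const t _
  · have h1 : HasDerivAt (fun s : ℝ => -(2 * s)) (-2) t :=
      hasDerivAt_of_quadratic 0 (-2) 0 (fun l => by ring) (by ring)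
    simpa [mul_comm] using h1.exp
  all_goals
    refine (hα _).congr_deriv ?_
    field_simp
    ring

/-- `Q` is arbitrary because the spatial parts of the fields do not involve it. -/
theorem hasDerivAt_groupX {k : Fin 10} {t : ℝ} {p : R3} (Q : R3) (h : groupDen k t p ≠ 0) :
    HasDerivAt (fun s => groupX k s p) (tableField k (groupX k t p, Q)).1 t := by
  have hsin := Real.hasDerivAt_sin t
  have hcos := Real.hasDerivAt_cos t
  have hexp := Real.hasDerivAt_exp t
  refine hasDerivAt_pi.2 fun l => ?_
  fin_cases k <;> fin_cases l <;> simp [tableField, groupX, groupDen] at h ⊢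
  iterate 9
    first
    | exact hasDerivAt_const t _
    | exact (hasDerivAt_id t).const_add _
  iterate 9
    first
    | exact hasDerivAt_const t _
    | exact ((hcos.mul_const _).sub (hsin.mul_const _)).congr_deriv (by ring)
    | exact ((hcos.mul_const _).add (hsin.mul_const _)).congr_deriv (by ring)
    | exact ((hsin.mul_const _).add (hcos.mul_const _)).congr_deriv (by ring)
    | exact ((hsin.mul_const _).neg.add (hcos.mul_const _)).congr_deriv (by ring)
  iterate 3 exact hexp.mul_const _
  · refine hasDerivAt_of_linear_div_alpha (p 0) (-rsq p) h (fun l => by ring) ?_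
    field_simp; simp [rsq, alpha]; ring
  · refine hasDerivAt_of_linear_div_alpha (p 1) 0 h (fun l => by ring) ?_
    field_simp; simp [rsq, alpha]; ring
  · refine hasDerivAt_of_linear_div_alpha (p 2) 0 h (fun l => by ring) ?_
    field_simp; simp [rsq, alpha]; ring
  · refine hasDerivAt_of_linear_div_alpha (p 0) 0 h (fun l => by ring) ?_
    field_simp; simp [rsq, alpha]; ring
  · refine hasDerivAt_of_linear_div_alpha (p 1) (-rsq p) h (fun l => by ring) ?_
    field_simp; simp [rsq, alpha]; ring
  · refine hasDerivAt_of_linear_div_alpha (p 2) 0 h (fun l => by ring) ?_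
    field_simp; simp [rsq, alpha]; ring
  · refine hasDerivAt_of_linear_div_alpha (p 0) 0 h (fun l => by ring) ?_
    field_simp; simp [rsq, alpha]; ring
  · refine hasDerivAt_of_linear_div_alpha (p 1) 0 h (fun l => by ring) ?_
    field_simp; simp [rsq, alpha]; ring
  · refine hasDerivAt_of_linear_div_alpha (p 2) (-rsq p) h (fun l => by ring) ?_
    field_simp; simp [rsq, alpha]; ring

theorem hasDerivAt_groupQ {k : Fin 10} {t : ℝ} {p Q : R3} (h : groupDen k t p ≠ 0) :
    HasDerivAt (fun s => groupQ k s p Q) (tableField k (groupX k t p, groupQ k t p Q)).2 t := by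
  have hsin := Real.hasDerivAt_sin t
  have hcos := Real.hasDerivAt_cos t
  have hexp : HasDerivAt (fun s : ℝ => Real.exp (-s)) (-Real.exp (-t)) t := by
    simpa using (hasDerivAt_neg t).exp
  refine hasDerivAt_pi.2 fun l => ?_
  fin_cases k <;> fin_cases l <;> simp [tableField, groupX, groupDen, groupQ] at h ⊢
  iterate 9 exact hasDerivAt_const t _
  iterate 9
    first
    | exact hasDerivAt_const t _
    | exact ((hcos.mul_const _).sub (hsin.mul_const _)).congr_deriv (by ring)
    | exact ((hcos.mul_const _).add (hsin.mul_const _)).congr_deriv (by ring)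
    | exact ((hsin.mul_const _).add (hcos.mul_const _)).congr_deriv (by ring)
    | exact ((hsin.mul_const _).neg.add (hcos.mul_const _)).congr_deriv (by ring)
  iterate 3 exact (hexp.mul_const _).congr_deriv (by ring)
  -- Although the conical action on `x` is rational in the parameter, the action on `Q` is
  -- polynomial of degree at most two.
  · refine hasDerivAt_of_quadratic (Q 0) (cfun p Q) (-(rsq p * Q 0 + cfun p Q * p 0))
      (fun l => by ring) ?_
    simp only [cfun]; simp; field_simp; simp [rsq, alpha]; ring
  · refine hasDerivAt_of_quadratic (Q 1) (2 * p 1 * Q 0 - 2 * p 0 * Q 1)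
      (rsq p * Q 1 + p 1 * cfun p Q) (fun l => by simp [alpha]; ring) ?_
    field_simp; simp [rsq, alpha, cfun]; ring
  · refine hasDerivAt_of_quadratic (Q 2) (2 * p 2 * Q 0 - 2 * p 0 * Q 2)
      (rsq p * Q 2 + p 2 * cfun p Q) (fun l => by simp [alpha]; ring) ?_
    field_simp; simp [rsq, alpha, cfun]; ring
  · refine hasDerivAt_of_quadratic (Q 0) (2 * p 0 * Q 1 - 2 * p 1 * Q 0)
      (rsq p * Q 0 + p 0 * cfun p Q) (fun l => by simp [alpha]; ring) ?_
    field_simp; simp [rsq, alpha, cfun]; ring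
  · refine hasDerivAt_of_quadratic (Q 1) (cfun p Q) (-(rsq p * Q 1 + cfun p Q * p 1))
      (fun l => by ring) ?_
    simp only [cfun]; simp; field_simp; simp [rsq, alpha]; ring
  · refine hasDerivAt_of_quadratic (Q 2) (2 * p 2 * Q 1 - 2 * p 1 * Q 2)
      (rsq p * Q 2 + p 2 * cfun p Q) (fun l => by simp [alpha]; ring) ?_
    field_simp; simp [rsq, alpha, cfun]; ring
  · refine hasDerivAt_of_quadratic (Q 0) (2 * p 0 * Q 2 - 2 * p 2 * Q 0)
      (rsq p * Q 0 + p 0 * cfun p Q) (fun l => by simp [alpha]; ring) ?_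
    field_simp; simp [rsq, alpha, cfun]; ring
  · refine hasDerivAt_of_quadratic (Q 1) (2 * p 1 * Q 2 - 2 * p 2 * Q 1)
      (rsq p * Q 1 + p 1 * cfun p Q) (fun l => by simp [alpha]; ring) ?_
    field_simp; simp [rsq, alpha, cfun]; ring
  · refine hasDerivAt_of_quadratic (Q 2) (cfun p Q) (-(rsq p * Q 2 + cfun p Q * p 2))
      (fun l => by ring) ?_
    simp only [cfun]; simp; field_simp; simp [rsq, alpha]; ring

theorem alpha_inverse {x r2 t d : ℝ} (hd : d = alpha x r2 t) (h : d ≠ 0) :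
    alpha ((x - t * r2) / d) (r2 / d) (-t) * d = 1 := by
  simp only [alpha] at hd ⊢
  field_simp
  linear_combination hd

/-- The numerator satisfies `|x - t r² e_i|² = r² α`. Hence `x / r²` is merely translated by `-t
e_i`: the conical groups are translations conjugated by inversion. -/
theorem rsq_groupX_conical (i : Fin 3) {t : ℝ} {p : R3} (h : groupDen (![7, 8, 9] i) t p ≠ 0) :
    rsq (groupX (![7, 8, 9] i) t p) = rsq p / groupDen (![7, 8, 9] i) t p := by
  obtain ⟨d, hd⟩ : ∃ d, d = alpha (p i) (rsq p) t := ⟨_, rfl⟩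
  fin_cases i <;> simp [groupX, groupDen, rsq] at h hd ⊢ <;> rw [← hd] at h ⊢ <;> field_simp <;>
    rw [hd, alpha] <;> ring

/-- In particular the inverse transformation is defined at every image point. -/
theorem groupDen_neg_mul {k : Fin 10} {t : ℝ} {p : R3} (h : groupDen k t p ≠ 0) :
    groupDen k (-t) (groupX k t p) * groupDen k t p = 1 := by
  have h7 := @rsq_groupX_conical 0 t p
  have h8 := @rsq_groupX_conical 1 t p
  have h9 := @rsq_groupX_conical 2 t p
  fin_cases k <;> simp [groupX, groupDen] at h h7 h8 h9 ⊢
  · rw [h7 h]; exact alpha_inverse rfl h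
  · rw [h8 h]; exact alpha_inverse rfl h
  · rw [h9 h]; exact alpha_inverse rfl h

theorem groupX_neg {k : Fin 10} {t : ℝ} {p : R3} (h : groupDen k t p ≠ 0) :
    groupX k (-t) (groupX k t p) = p := by
  have h1 := groupDen_neg_mul h
  have hc := Real.cos_sq_add_sin_sq t
  have he : Real.exp (-t) * Real.exp t = 1 := by rw [← Real.exp_add]; simp
  have h2 : groupDen k (-t) (groupX k t p) = (groupDen k t p)⁻¹ := eq_inv_of_mul_eq_one_left h1
  have h7 := @rsq_groupX_conical 0 t p
  have h8 := @rsq_groupX_conical 1 t p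
  have h9 := @rsq_groupX_conical 2 t p
  ext l
  rw [groupX, h2]
  fin_cases k
  iterate 3 fin_cases l <;> simp [groupX]
  iterate 3
    fin_cases l <;> simp [groupX] <;>
    first
    | done
    | linear_combination (p 0) * hc
    | linear_combination (p 1) * hc
    | linear_combination (p 2) * hc
  · fin_cases l <;> simp [groupX]
    · linear_combination (p 0) * he
    · linear_combination (p 1) * he
    · linear_combination (p 2) * he
  · simp at h h7
    simp only [Fin.reduceFinMk, h7 h]
    fin_cases l <;> simp [groupX] <;> field_simp <;> ring
  · simp at h h8
    simp only [Fin.reduceFinMk, h8 h]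
    fin_cases l <;> simp [groupX] <;> field_simp <;> ring
  · simp at h h9
    simp only [Fin.reduceFinMk, h9 h]
    fin_cases l <;> simp [groupX] <;> field_simp <;> ring

theorem rsq_ne_zero {p : R3} (hp : p ≠ 0) : rsq p ≠ 0 := by
  contrapose! hp
  simp only [rsq] at hp
  have h0 : p 0 = 0 := by nlinarith [sq_nonneg (p 0), sq_nonneg (p 1), sq_nonneg (p 2)]
  have h1 : p 1 = 0 := by nlinarith [sq_nonneg (p 0), sq_nonneg (p 1), sq_nonneg (p 2)]
  have h2 : p 2 = 0 := by nlinarith [sq_nonneg (p 0), sq_nonneg (p 1), sq_nonneg (p 2)]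
  ext l
  fin_cases l <;> assumption

theorem groupX_conical_zero (i : Fin 3) (t : ℝ) : groupX (![7, 8, 9] i) t 0 = 0 := by
  ext l
  fin_cases i <;> fin_cases l <;> simp [groupX, rsq]

theorem isOpen_tableRegion (k : Fin 10) : IsOpen (tableRegion k) := by
  fin_cases k <;> simp only [tableRegion]
  iterate 6 exact isOpen_univ
  · exact isOpen_ne_fun (continuous_apply 0) continuous_const
  all_goals exact isOpen_ne

theorem dense_tableRegion (k : Fin 10) : Dense (tableRegion k) := by
  fin_cases k <;> simp only [tableRegion]
  iterate 6 exact dense_univ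
  · exact (dense_compl_singleton (0 : ℝ)).preimage (isOpenMap_eval (0 : Fin 3))
  all_goals exact dense_compl_singleton (0 : R3)

theorem groupX_mem_tableRegion {k : Fin 10} {t : ℝ} {p : R3} (hp : p ∈ tableRegion k)
    (h : groupDen k t p ≠ 0) : groupX k t p ∈ tableRegion k := by
  have key : ∀ i : Fin 3, p ≠ 0 → groupDen (![7, 8, 9] i) t p ≠ 0 →
      groupX (![7, 8, 9] i) t p ≠ 0 := fun i hp h h0 => by
    have := groupX_neg h
    rw [h0, groupX_conical_zero] at this
    exact hp this.symm
  fin_cases k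
  iterate 6 exact Set.mem_univ _
  · have h1 : p 0 ≠ 0 := hp
    show Real.exp t * p 0 ≠ 0
    positivity
  · exact key 0 hp h
  · exact key 1 hp h
  · exact key 2 hp h

theorem tableFactor_groupX {k : Fin 10} {t : ℝ} {p : R3} (h : groupDen k t p ≠ 0) :
    tableFactor k (groupX k t p) = groupWeight k t p * tableFactor k p := by
  have h7 := @rsq_groupX_conical 0 t p
  have h8 := @rsq_groupX_conical 1 t p
  have h9 := @rsq_groupX_conical 2 t p
  fin_cases k <;> simp [tableFactor, groupWeight] at h h7 h8 h9 ⊢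
  · simp [groupX, mul_pow, Real.exp_neg, two_mul, Real.exp_add]
    ring
  · rw [h7 h]; simp [groupDen, div_eq_mul_inv, mul_pow]
  · rw [h8 h]; simp [groupDen, div_eq_mul_inv, mul_pow]
  · rw [h9 h]; simp [groupDen, div_eq_mul_inv, mul_pow]

theorem rotation_sq (t y z : ℝ) : (Real.cos t * y - Real.sin t * z) ^ 2
    + (Real.sin t * y + Real.cos t * z) ^ 2 = y ^ 2 + z ^ 2 := by
  linear_combination (y ^ 2 + z ^ 2) * Real.cos_sq_add_sin_sq t

theorem tableInvariant_groupX {k : Fin 10} {t : ℝ} {p : R3} (h : groupDen k t p ≠ 0) :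
    tableInvariant k (groupX k t p) = tableInvariant k p := by
  have h7 := @rsq_groupX_conical 0 t p
  have h8 := @rsq_groupX_conical 1 t p
  have h9 := @rsq_groupX_conical 2 t p
  fin_cases k
  iterate 3 simp [tableInvariant, groupX]
  · simp [tableInvariant, groupX, rotation_sq]
  · have := rotation_sq t (p 2) (p 0)
    have e : (Real.cos t * p 0 + Real.sin t * p 2) ^ 2 + (-(Real.sin t * p 0) + Real.cos t * p 2) ^ 2
      = p 0 ^ 2 + p 2 ^ 2 := by linarith
    simp [tableInvariant, groupX, e]
  · simp [tableInvariant, groupX, rotation_sq]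
  · simp [tableInvariant, groupX, mul_div_mul_left _ _ (Real.exp_ne_zero t)]
  · simp at h h7
    simp only [tableInvariant, Fin.reduceFinMk, h7 h]
    simp [groupX, div_div_div_cancel_right₀ h]
  · simp at h h8
    simp only [tableInvariant, Fin.reduceFinMk, h8 h]
    simp [groupX, div_div_div_cancel_right₀ h]
  · simp at h h9
    simp only [tableInvariant, Fin.reduceFinMk, h9 h]
    simp [groupX, div_div_div_cancel_right₀ h]

theorem tablePotential_groupX {k : Fin 10} {t : ℝ} {p : R3} (F : ℝ × ℝ → ℝ)
    (h : groupDen k t p ≠ 0) :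
    tablePotential k F (groupX k t p) = groupWeight k t p * tablePotential k F p := by
  rw [tablePotential, tablePotential, tableFactor_groupX h, tableInvariant_groupX h, mul_assoc]

theorem contDiff_groupDen (k : Fin 10) :
    ContDiff ℝ ∞ fun s : ℝ × R3 => groupDen k s.1 s.2 := by
  fin_cases k <;> simp [groupDen, alpha, rsq] <;> fun_prop

theorem contDiffAt_groupX {k : Fin 10} {s : ℝ × R3} (h : groupDen k s.1 s.2 ≠ 0) :
    ContDiffAt ℝ ∞ (fun s : ℝ × R3 => groupX k s.1 s.2) s := by
  have hd := (contDiff_groupDen k).contDiffAt (x := s)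
  refine contDiffAt_pi.2 fun l => ?_
  fin_cases k
  iterate 7 fin_cases l <;> simp [groupX] <;> fun_prop
  all_goals
    fin_cases l <;> simp [groupX, rsq] <;> refine ContDiffAt.div ?_ hd h <;> fun_prop

/-! ### The potential along orbits -/

/-- Along the groups, a potential satisfying the first-order condition is multiplied by the
weight. -/
theorem potential_groupX {Ω : Set R3} (hΩ : IsOpen Ω) {q : R3 → ℝ} (hq : ContDiffOn ℝ 1 q Ω)
    {k : Fin 10} (hc : ∀ p ∈ Ω, CondQ (tableParam k) q p) {t : ℝ} {p : R3}
    (hp : ∀ s ∈ Set.uIcc 0 t, groupDen k s p ≠ 0 ∧ groupX k s p ∈ Ω) :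
    q (groupX k t p) = groupWeight k t p * q p := by
  -- The potential and the weight satisfy the same linear equation, so their quotient has zero
  -- derivative.
  have hd : ∀ s ∈ Set.uIcc 0 t,
      HasDerivAt (fun s => q (groupX k s p) / groupWeight k s p) 0 s := fun s hs => by
    obtain ⟨h1, h2⟩ := hp s hs
    have hq' := (hq.contDiffAt (hΩ.mem_nhds h2)).differentiableAt one_ne_zero
    have h3 := hq'.hasFDerivAt.comp_hasDerivAt s (hasDerivAt_groupX 0 h1)
    have h4 := h3.div (hasDerivAt_groupWeight h1) (groupWeight_ne_zero h1)
    refine h4.congr_deriv ?_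
    have h5 := (condQ_tableParam_iff k q (groupX k s p, 0)).1 (hc _ h2)
    simp only at h5
    rw [eq_neg_of_add_eq_zero_left h5]
    simp
    ring_nf
    simp
  have h := (convex_uIcc (0 : ℝ) t).norm_image_sub_le_of_norm_hasDerivWithin_le (C := 0)
    (fun s hs => (hd s hs).hasDerivWithinAt) (by simp) Set.left_mem_uIcc Set.right_mem_uIcc
  simp only [zero_mul, groupX_zero, groupWeight_zero, div_one] at h
  have h1 := sub_eq_zero.1 (norm_le_zero_iff.1 h)
  rwa [div_eq_iff (groupWeight_ne_zero (hp t Set.right_mem_uIcc).1), mul_comm] at h1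

/-! ### Orbits joining points with the same invariants -/

/-- The angle of the rotation taking `(y₁, z₁)` to `(y₂, z₂)`. -/
noncomputable def rotAngle (y₁ z₁ y₂ z₂ : ℝ) : ℝ :=
  Complex.arg ((⟨y₂, z₂⟩ : ℂ) / ⟨y₁, z₁⟩)

/-- The complex quotient has modulus one, hence is `exp (i arg)`. If one point is the origin so is
the other, and any angle works. -/
theorem rotAngle_spec {y₁ z₁ y₂ z₂ : ℝ} (h : √(y₁ ^ 2 + z₁ ^ 2) = √(y₂ ^ 2 + z₂ ^ 2)) :
    Real.cos (rotAngle y₁ z₁ y₂ z₂) * y₁ - Real.sin (rotAngle y₁ z₁ y₂ z₂) * z₁ = y₂ ∧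
      Real.sin (rotAngle y₁ z₁ y₂ z₂) * y₁ + Real.cos (rotAngle y₁ z₁ y₂ z₂) * z₁ = z₂ := by
  obtain ⟨w₁, hw₁⟩ : ∃ w : ℂ, w = ⟨y₁, z₁⟩ := ⟨_, rfl⟩
  obtain ⟨w₂, hw₂⟩ : ∃ w : ℂ, w = ⟨y₂, z₂⟩ := ⟨_, rfl⟩
  have hn : ‖w₁‖ = ‖w₂‖ := by
    rw [Complex.norm_eq_sqrt_sq_add_sq, Complex.norm_eq_sqrt_sq_add_sq, hw₁, hw₂]; exact h
  have key : Complex.exp (rotAngle y₁ z₁ y₂ z₂ * Complex.I) * w₁ = w₂ := by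
    rcases eq_or_ne w₁ 0 with h0 | h0
    · have : w₂ = 0 := norm_eq_zero.1 (by rw [← hn, h0, norm_zero])
      simp [h0, this]
    · have h1 := Complex.norm_mul_exp_arg_mul_I (w₂ / w₁)
      rw [norm_div, hn, div_self (by rw [← hn]; exact norm_ne_zero_iff.2 h0)] at h1
      rw [Complex.ofReal_one, one_mul] at h1
      rw [rotAngle, ← hw₁, ← hw₂, eq_comm, ← div_eq_iff h0, h1]
  rw [Complex.exp_mul_I, ← Complex.ofReal_cos, ← Complex.ofReal_sin, hw₁, hw₂] at key
  have hre := congrArg Complex.re key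
  have him := congrArg Complex.im key
  simp [Complex.cos_ofReal_re, Complex.sin_ofReal_re] at hre him
  constructor <;> linarith

theorem tendsto_rotAngle {X : Type*} [TopologicalSpace X] {f g f' g' : X → ℝ} {x : X}
    (hf : ContinuousAt f x) (hg : ContinuousAt g x) (hf' : ContinuousAt f' x)
    (hg' : ContinuousAt g' x) (h1 : f x = f' x) (h2 : g x = g' x) (h : f x ≠ 0 ∨ g x ≠ 0) :
    Filter.Tendsto (fun y => rotAngle (f y) (g y) (f' y) (g' y)) (𝓝 x) (𝓝 0) := by
  have hne : (⟨f x, g x⟩ : ℂ) ≠ 0 := fun h0 => by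
    have hre := congrArg Complex.re h0
    have him := congrArg Complex.im h0
    simp at hre him
    tauto
  have hc : ∀ {f g : X → ℝ}, ContinuousAt f x → ContinuousAt g x →
      ContinuousAt (fun y => (⟨f y, g y⟩ : ℂ)) x := fun {f g} hf hg => by
    have : (fun y => (⟨f y, g y⟩ : ℂ)) = fun y => (f y : ℂ) + g y * Complex.I := by
      funext y; exact Complex.mk_eq_add_mul_I _ _
    rw [this]
    fun_prop
  have hd : Filter.Tendsto (fun y => (⟨f' y, g' y⟩ : ℂ) / ⟨f y, g y⟩) (𝓝 x) (𝓝 1) := by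
    have := (hc hf' hg').tendsto.div (hc hf hg).tendsto hne
    rwa [← h1, ← h2, div_self hne] at this
  have ha : Filter.Tendsto Complex.arg (𝓝 1) (𝓝 0) := by
    simpa using (Complex.continuousAt_arg Complex.one_mem_slitPlane).tendsto
  exact ha.comp hd

/-- A parameter joining two points with the same invariants. -/
noncomputable def groupTime (k : Fin 10) (p₁ p₂ : R3) : ℝ :=
  ![p₂ 0 - p₁ 0, p₂ 1 - p₁ 1, p₂ 2 - p₁ 2,
    rotAngle (p₁ 1) (p₁ 2) (p₂ 1) (p₂ 2), rotAngle (p₁ 2) (p₁ 0) (p₂ 2) (p₂ 0),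
    rotAngle (p₁ 0) (p₁ 1) (p₂ 0) (p₂ 1),
    Real.log (p₂ 0 / p₁ 0), p₁ 0 / rsq p₁ - p₂ 0 / rsq p₂, p₁ 1 / rsq p₁ - p₂ 1 / rsq p₂,
    p₁ 2 / rsq p₁ - p₂ 2 / rsq p₂] k

/-- In the inverted coordinates `x / r²` the flow is a translation along one axis, and `s` is the
difference of the coordinates along it. -/
theorem conical_time {x₁ y₁ z₁ R₁ x₂ y₂ z₂ R₂ s : ℝ} (h₁ : R₁ ≠ 0) (h₂ : R₂ ≠ 0)
    (e₁ : R₁ = x₁ ^ 2 + (y₁ ^ 2 + z₁ ^ 2)) (e₂ : R₂ = x₂ ^ 2 + (y₂ ^ 2 + z₂ ^ 2))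
    (hy : y₁ / R₁ = y₂ / R₂) (hz : z₁ / R₁ = z₂ / R₂) (hs : s = x₁ / R₁ - x₂ / R₂) :
    (x₁ - s * R₁) / alpha x₁ R₁ s = x₂ ∧ y₁ / alpha x₁ R₁ s = y₂ ∧ z₁ / alpha x₁ R₁ s = z₂ := by
  rw [div_eq_div_iff h₁ h₂] at hy hz
  have hs' : s * R₁ * R₂ = x₁ * R₂ - x₂ * R₁ := by rw [hs]; field_simp
  have hα : alpha x₁ R₁ s = R₁ / R₂ := by
    rw [eq_div_iff h₂]
    apply mul_right_cancel₀ (mul_ne_zero h₁ h₂)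
    simp only [alpha]
    linear_combination hs' * (s * R₁ * R₂ + x₁ * R₂ - x₂ * R₁ - 2 * x₁ * R₂)
      + (y₁ * R₂ + y₂ * R₁) * hy + (z₁ * R₂ + z₂ * R₁) * hz + R₂ ^ 2 * e₁ - R₁ ^ 2 * e₂
  rw [hα]
  refine ⟨?_, ?_, ?_⟩ <;> field_simp
  · linear_combination -hs'
  · linear_combination hy
  · linear_combination hz

/-- `hpos` is needed for the dilation because `y/x` and `z/x` agree at opposite points, which lie on
different orbits. -/
theorem groupX_groupTime {k : Fin 10} {p₁ p₂ : R3} (h₁ : p₁ ∈ tableRegion k)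
    (h₂ : p₂ ∈ tableRegion k) (hpos : k = 6 → 0 < p₂ 0 / p₁ 0)
    (h : tableInvariant k p₁ = tableInvariant k p₂) :
    groupX k (groupTime k p₁ p₂) p₁ = p₂ := by
  fin_cases k
  iterate 3
    simp [tableInvariant] at h
    ext l
    fin_cases l <;> simp [groupX, groupTime, h]
  · simp [tableInvariant] at h
    have := rotAngle_spec h.2
    ext l
    fin_cases l <;> simp [groupX, groupTime, h.1, this]
  · simp [tableInvariant] at h
    have := rotAngle_spec (y₁ := p₁ 2) (z₁ := p₁ 0) (y₂ := p₂ 2) (z₂ := p₂ 0)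
      (by rw [add_comm, h.2, add_comm])
    ext l
    fin_cases l <;> simp [groupX, groupTime, h.1] <;> linarith [this.1, this.2]
  · simp [tableInvariant] at h
    have := rotAngle_spec h.2
    ext l
    fin_cases l <;> simp [groupX, groupTime, h.1, this]
  · have h1 : p₁ 0 ≠ 0 := h₁
    have h2 : p₂ 0 ≠ 0 := h₂
    simp [tableInvariant] at h
    rw [div_eq_div_iff h1 h2, div_eq_div_iff h1 h2] at h
    ext l
    fin_cases l <;> simp [groupX, groupTime, Real.exp_log (hpos rfl)] <;> field_simp
    · linarith [h.1]
    · linarith [h.2]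
  · simp [tableInvariant] at h
    have := conical_time (rsq_ne_zero h₁) (rsq_ne_zero h₂) (by simp only [rsq]; ring)
      (by simp only [rsq]; ring) h.1 h.2 rfl
    ext l
    fin_cases l <;> simp [groupX, groupDen, groupTime, this]
  · simp [tableInvariant] at h
    have := conical_time (x₁ := p₁ 1) (x₂ := p₂ 1) (rsq_ne_zero h₁) (rsq_ne_zero h₂)
      (by simp only [rsq]; ring) (by simp only [rsq]; ring) h.1 h.2 rfl
    ext l
    fin_cases l <;> simp [groupX, groupDen, groupTime, this]
  · simp [tableInvariant] at h
    have := conical_time (x₁ := p₁ 2) (x₂ := p₂ 2) (rsq_ne_zero h₁) (rsq_ne_zero h₂)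
      (by simp only [rsq]; ring) (by simp only [rsq]; ring) h.1 h.2 rfl
    ext l
    fin_cases l <;> simp [groupX, groupDen, groupTime, this]

/-- The points fixed by a group of rotations. -/
def rotationAxis (k : Fin 10) : Set R3 :=
  ![∅, ∅, ∅, {p | p 1 = 0 ∧ p 2 = 0}, {p | p 2 = 0 ∧ p 0 = 0}, {p | p 0 = 0 ∧ p 1 = 0},
    ∅, ∅, ∅, ∅] k

theorem tendsto_groupTime {k : Fin 10} {p : R3} (hp : p ∈ tableRegion k) (h : p ∉ rotationAxis k) :
    Filter.Tendsto (fun P : R3 × R3 => groupTime k P.1 P.2) (𝓝 (p, p)) (𝓝 0) := by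
  have hr : Continuous rsq := by unfold rsq; fun_prop
  have h7 : ∀ i, p ≠ 0 →
      ContinuousAt (fun P : R3 × R3 => P.1 i / rsq P.1 - P.2 i / rsq P.2) (p, p) := fun i hp => by
    have h1 : ContinuousAt (fun P : R3 × R3 => P.1 i / rsq P.1) (p, p) :=
      ContinuousAt.div (by fun_prop) (by fun_prop) (rsq_ne_zero hp)
    have h2 : ContinuousAt (fun P : R3 × R3 => P.2 i / rsq P.2) (p, p) :=
      ContinuousAt.div (by fun_prop) (by fun_prop) (rsq_ne_zero hp)
    exact h1.sub h2
  have h7' : ∀ i, p ≠ 0 →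
      Filter.Tendsto (fun P : R3 × R3 => P.1 i / rsq P.1 - P.2 i / rsq P.2) (𝓝 (p, p)) (𝓝 0) :=
    fun i hp => by simpa [ContinuousAt] using h7 i hp
  have h0 : ∀ i, Filter.Tendsto (fun P : R3 × R3 => P.2 i - P.1 i) (𝓝 (p, p)) (𝓝 0) := fun i => by
    have : ContinuousAt (fun P : R3 × R3 => P.2 i - P.1 i) (p, p) := by fun_prop
    simpa [ContinuousAt] using this
  have h3 : ∀ i j, ¬ (p i = 0 ∧ p j = 0) → Filter.Tendsto
      (fun P : R3 × R3 => rotAngle (P.1 i) (P.1 j) (P.2 i) (P.2 j)) (𝓝 (p, p)) (𝓝 0) :=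
    fun i j h => tendsto_rotAngle (by fun_prop) (by fun_prop) (by fun_prop) (by fun_prop) rfl rfl
      (by tauto)
  fin_cases k
  · exact h0 0
  · exact h0 1
  · exact h0 2
  · exact h3 1 2 h
  · exact h3 2 0 h
  · exact h3 0 1 h
  · have h1 : p 0 ≠ 0 := hp
    have : ContinuousAt (fun P : R3 × R3 => Real.log (P.2 0 / P.1 0)) (p, p) :=
      ContinuousAt.log (ContinuousAt.div (f := fun P : R3 × R3 => P.2 0) (g := fun P => P.1 0)
        (by fun_prop) (by fun_prop) h1) (div_ne_zero h1 h1)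
    show Filter.Tendsto (fun P : R3 × R3 => Real.log (P.2 0 / P.1 0)) _ _
    simpa [ContinuousAt, h1] using this
  · exact h7' 0 hp
  · exact h7' 1 hp
  · exact h7' 2 hp

/-- Near the axis the joining angle need not be small, but the whole circle through a nearby point
stays in `Ω`. -/
theorem eventually_orbit_mem_of_mem_rotationAxis {Ω : Set R3} (hΩ : IsOpen Ω) {k : Fin 10} {p : R3}
    (hpΩ : p ∈ Ω) (h : p ∈ rotationAxis k) :
    ∀ᶠ p₁ in 𝓝 p, ∀ s, groupDen k s p₁ ≠ 0 ∧ groupX k s p₁ ∈ Ω := by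
  obtain ⟨ε, hε, hb⟩ := Metric.isOpen_iff.1 hΩ p hpΩ
  -- The radius is halved because a rotation can enlarge the sup norm, by a factor of at most two.
  filter_upwards [Metric.ball_mem_nhds p (half_pos hε)] with p₁ hp₁ s
  have hc : ∀ a b : ℝ, |a| < ε / 2 → |b| < ε / 2 → |Real.cos s * a - Real.sin s * b| < ε ∧
      |Real.sin s * a + Real.cos s * b| < ε := fun a b ha hb => by
    have h1 : |Real.cos s * a| ≤ |a| := by
      rw [abs_mul]; exact mul_le_of_le_one_left (abs_nonneg _) (Real.abs_cos_le_one s)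
    have h2 : |Real.sin s * b| ≤ |b| := by
      rw [abs_mul]; exact mul_le_of_le_one_left (abs_nonneg _) (Real.abs_sin_le_one s)
    have h3 : |Real.sin s * a| ≤ |a| := by
      rw [abs_mul]; exact mul_le_of_le_one_left (abs_nonneg _) (Real.abs_sin_le_one s)
    have h4 : |Real.cos s * b| ≤ |b| := by
      rw [abs_mul]; exact mul_le_of_le_one_left (abs_nonneg _) (Real.abs_cos_le_one s)
    exact ⟨by linarith [abs_sub (Real.cos s * a) (Real.sin s * b)],
      by linarith [abs_add_le (Real.sin s * a) (Real.cos s * b)]⟩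
  have hd : ∀ l, |p₁ l - p l| < ε / 2 := fun l => by
    have := (dist_pi_lt_iff (half_pos hε)).1 (Metric.mem_ball.1 hp₁) l
    rwa [Real.dist_eq] at this
  have hd' : ∀ l, |p₁ l - p l| < ε := fun l => (hd l).trans (half_lt_self hε)
  refine ⟨?_, hb (Metric.mem_ball.2 ((dist_pi_lt_iff hε).2 fun l => ?_))⟩
  · fin_cases k <;> simp [rotationAxis] at h <;> simp [groupDen]
  · rw [Real.dist_eq]
    fin_cases k <;> simp [rotationAxis] at h
    · have h1 := hd 1
      have h2 := hd 2
      have h0 := hd' 0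
      rw [h.1, sub_zero] at h1
      rw [h.2, sub_zero] at h2
      fin_cases l <;> simp [groupX, h, h0, hc _ _ h1 h2]
    · have h1 := hd 2
      have h2 := hd 0
      have h0 := hd' 1
      rw [h.1, sub_zero] at h1
      rw [h.2, sub_zero] at h2
      have h3 := hc _ _ h1 h2
      rw [add_comm] at h3
      have h4 : |-(Real.sin s * p₁ 0) + Real.cos s * p₁ 2| < ε := by
        rw [neg_add_eq_sub]; exact h3.1
      fin_cases l <;> simp [groupX, h, h0, h3, h4]
    · have h1 := hd 0
      have h2 := hd 1
      have h0 := hd' 2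
      rw [h.1, sub_zero] at h1
      rw [h.2, sub_zero] at h2
      fin_cases l <;> simp [groupX, h, h0, hc _ _ h1 h2]

theorem eventually_orbit_mem {Ω : Set R3} (hΩ : IsOpen Ω) (k : Fin 10) {p : R3} (hpΩ : p ∈ Ω) :
    ∀ᶠ P : ℝ × R3 in 𝓝 (0, p), groupDen k P.1 P.2 ≠ 0 ∧ groupX k P.1 P.2 ∈ Ω := by
  have h0 : groupDen k ((0, p) : ℝ × R3).1 ((0, p) : ℝ × R3).2 ≠ 0 := by simp [groupDen_zero]
  refine Filter.Eventually.and ?_ ?_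
  · exact (contDiff_groupDen k).continuous.continuousAt.eventually_ne h0
  · exact (contDiffAt_groupX h0).continuousAt.eventually_mem
      (hΩ.mem_nhds (by simpa [groupX_zero] using hpΩ))

/-- Points with the same invariants near a given point are joined by short orbits. -/
theorem exists_nhds_orbit {Ω : Set R3} (hΩ : IsOpen Ω) {k : Fin 10} {p : R3}
    (hp : p ∈ Ω ∩ tableRegion k) :
    ∃ V ∈ 𝓝 p, V ⊆ Ω ∩ tableRegion k ∧ ∀ p₁ ∈ V, ∀ p₂ ∈ V,
      tableInvariant k p₁ = tableInvariant k p₂ → ∃ s, groupX k s p₁ = p₂ ∧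
        ∀ s' ∈ Set.uIcc 0 s, groupDen k s' p₁ ≠ 0 ∧ groupX k s' p₁ ∈ Ω := by
  have hV : Ω ∩ tableRegion k ∈ 𝓝 p := (hΩ.inter (isOpen_tableRegion k)).mem_nhds hp
  have key : ∀ᶠ P : R3 × R3 in 𝓝 (p, p), tableInvariant k P.1 = tableInvariant k P.2 →
      ∃ s, groupX k s P.1 = P.2 ∧
        ∀ s' ∈ Set.uIcc 0 s, groupDen k s' P.1 ≠ 0 ∧ groupX k s' P.1 ∈ Ω := by
    have hR : ∀ᶠ P : R3 × R3 in 𝓝 (p, p), P.1 ∈ tableRegion k ∧ P.2 ∈ tableRegion k ∧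
        (k = 6 → 0 < P.2 0 / P.1 0) := by
      have h1 := (isOpen_tableRegion k).mem_nhds hp.2
      refine (continuousAt_fst.eventually_mem h1).and ((continuousAt_snd.eventually_mem h1).and ?_)
      by_cases hk : k = 6
      · subst hk
        have h2 : p 0 ≠ 0 := hp.2
        have h3 : ContinuousAt (fun P : R3 × R3 => P.2 0 / P.1 0) (p, p) :=
          ContinuousAt.div (by fun_prop) (by fun_prop) h2
        have h4 : 0 < (p, p).2 0 / (p, p).1 0 := by simp [h2]
        filter_upwards [h3.eventually (lt_mem_nhds h4)] with P hP _ using hP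
      · simp [hk]
    by_cases hax : p ∈ rotationAxis k
    · have h1 := continuousAt_fst.eventually
        (eventually_orbit_mem_of_mem_rotationAxis (p := ((p, p) : R3 × R3).1) hΩ hp.1 hax)
      filter_upwards [hR, h1] with P ⟨hP1, hP2, hP3⟩ hP hinv
      exact ⟨_, groupX_groupTime hP1 hP2 hP3 hinv, fun s' _ => hP s'⟩
    · have h1 := eventually_orbit_mem hΩ k hp.1
      rw [nhds_prod_eq] at h1
      obtain ⟨A, hA, B, hB, hAB⟩ := Filter.eventually_prod_iff.1 h1
      obtain ⟨δ, hδ, hδA⟩ := Metric.eventually_nhds_iff_ball.1 hA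
      have h2 := (tendsto_groupTime hp.2 hax).eventually (Metric.ball_mem_nhds 0 hδ)
      have h3 : ∀ᶠ P : R3 × R3 in 𝓝 (p, p), B P.1 := continuousAt_fst.eventually hB
      filter_upwards [hR, h2, h3] with P ⟨hP1, hP2, hP3⟩ hP4 hP5 hinv
      -- Off the axis the joining parameter lies in the `δ`-ball about zero, hence so do all
      -- intermediate ones.
      refine ⟨_, groupX_groupTime hP1 hP2 hP3 hinv, fun s' hs' => hAB (hδA s' ?_) hP5⟩
      have := (convex_ball (0 : ℝ) δ).ordConnected.uIcc_subset (Metric.mem_ball_self hδ) hP4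
      exact this hs'
  rw [nhds_prod_eq] at key
  obtain ⟨W, hW, hW'⟩ := Filter.mem_prod_self_iff.1 key
  exact ⟨W ∩ (Ω ∩ tableRegion k), Filter.inter_mem hW hV, Set.inter_subset_right,
    fun p₁ h₁ p₂ h₂ h => hW' (Set.mk_mem_prod h₁.1 h₂.1) h⟩

/-! ### Potentials admitting a given field -/

theorem tableFactor_ne_zero {k : Fin 10} {p : R3} (hp : p ∈ tableRegion k) :
    tableFactor k p ≠ 0 := by
  fin_cases k
  iterate 6 exact one_ne_zero
  · exact inv_ne_zero (pow_ne_zero 2 hp)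
  all_goals exact inv_ne_zero (pow_ne_zero 2 (rsq_ne_zero hp))

/-- A potential is locally of the form of the table if and only if its quotient by the factor is
locally constant on the level sets of the invariants. -/
theorem exists_tablePotential {k : Fin 10} {q : R3 → ℝ} {V : Set R3} (hV : V ⊆ tableRegion k)
    (h : ∀ p₁ ∈ V, ∀ p₂ ∈ V, tableInvariant k p₁ = tableInvariant k p₂ →
      q p₁ / tableFactor k p₁ = q p₂ / tableFactor k p₂) :
    ∃ F : ℝ × ℝ → ℝ, ∀ p ∈ V, q p = tablePotential k F p := by
  classical
  -- `F` is read off at a chosen point of each level set; the value `0` at pairs not attained on `V`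
  -- is irrelevant.
  refine ⟨fun c => if hc : ∃ p ∈ V, tableInvariant k p = c then
    q hc.choose / tableFactor k hc.choose else 0, fun p hp => ?_⟩
  have hc : ∃ p' ∈ V, tableInvariant k p' = tableInvariant k p := ⟨p, hp, rfl⟩
  rw [tablePotential, dif_pos hc, h _ hc.choose_spec.1 p hp hc.choose_spec.2,
    mul_div_cancel₀ _ (tableFactor_ne_zero (hV hp))]

/-- The potential and the prefactor acquire the same weight along the short orbit between two points
with equal invariants, so their quotient agrees at both ends. -/
theorem local_form_of_condQ {Ω : Set R3} (hΩ : IsOpen Ω) {q : R3 → ℝ}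
    (hq : ContDiffOn ℝ 1 q Ω) {k : Fin 10} (hc : ∀ p ∈ Ω, CondQ (tableParam k) q p) {p : R3}
    (hp : p ∈ Ω ∩ tableRegion k) :
    ∃ F : ℝ × ℝ → ℝ, ∀ᶠ p' in 𝓝 p, q p' = tablePotential k F p' := by
  obtain ⟨V, hV, hVs, hVo⟩ := exists_nhds_orbit hΩ hp
  obtain ⟨F, hF⟩ := exists_tablePotential (q := q) (hVs.trans Set.inter_subset_right)
    fun p₁ h₁ p₂ h₂ h => by
      obtain ⟨s, rfl, hs⟩ := hVo p₁ h₁ p₂ h₂ h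
      have hd := (hs s Set.right_mem_uIcc).1
      rw [potential_groupX hΩ hq hc hs, tableFactor_groupX hd,
        mul_div_mul_left _ _ (groupWeight_ne_zero hd)]
  exact ⟨F, Filter.mem_of_superset hV hF⟩

/-- Differentiating the weight law along the orbit at parameter zero requires no regularity of `F`.
Points of `Ω` outside the region are reached by density, the condition being continuous for `q` of
class `C¹`. -/
theorem condQ_of_local_form {Ω : Set R3} (hΩ : IsOpen Ω) {q : R3 → ℝ}
    (hq : ContDiffOn ℝ 1 q Ω) {k : Fin 10}
    (h : ∀ p ∈ Ω ∩ tableRegion k, ∃ F : ℝ × ℝ → ℝ,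
    ∀ᶠ p' in 𝓝 p, q p' = tablePotential k F p') : ∀ p ∈ Ω, CondQ (tableParam k) q p := by
  have h1 : ∀ p ∈ Ω ∩ tableRegion k,
      fderiv ℝ q p (tableField k (p, 0)).1 + 2 * tableRate k p * q p = 0 := by
    intro p hp
    obtain ⟨F, hF⟩ := h p hp
    have hd0 : groupDen k 0 p ≠ 0 := by simp [groupDen_zero]
    have hqp : DifferentiableAt ℝ q (groupX k 0 p) := by
      rw [groupX_zero]
      exact (hq.contDiffAt (hΩ.mem_nhds hp.1)).differentiableAt one_ne_zero
    have hX := hasDerivAt_groupX 0 hd0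
    have h2 := hqp.hasFDerivAt.comp_hasDerivAt (0 : ℝ) hX
    have h3 := (hasDerivAt_groupWeight hd0).mul_const (q p)
    have h4 : (q ∘ fun s => groupX k s p) =ᶠ[𝓝 0] fun s => groupWeight k s p * q p := by
      obtain ⟨W, hWF, hWo, hpW⟩ := eventually_nhds_iff.1 hF
      have e : ∀ᶠ s : ℝ in 𝓝 0, groupDen k s p ≠ 0 ∧ groupX k s p ∈ W :=
        ((Continuous.prodMk_left p).tendsto (0 : ℝ)).eventually (eventually_orbit_mem hWo k hpW)
      filter_upwards [e] with s hs
      rw [Function.comp_apply, hWF _ hs.2, tablePotential_groupX F hs.1, hF.self_of_nhds]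
    have h5 := h2.unique (h3.congr_of_eventuallyEq h4)
    rw [groupX_zero, groupWeight_zero] at h5
    rw [h5]
    ring
  have hE : ContinuousOn
      (fun p => fderiv ℝ q p (tableField k (p, 0)).1 + 2 * tableRate k p * q p) Ω := by
    have c1 : ContinuousOn (fderiv ℝ q) Ω := hq.continuousOn_fderiv_of_isOpen hΩ le_rfl
    have c2 : Continuous fun p : R3 => (tableField k (p, 0)).1 := by
      rw [tableField_eq_genField]
      exact continuous_fst.comp ((contDiff_genField _).continuous.comp
        (by fun_prop : Continuous fun p : R3 => (p, (0 : R3))))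
    have c3 : Continuous (tableRate k) := by
      unfold tableRate
      fin_cases k <;> simp <;> fun_prop
    exact (c1.clm_apply c2.continuousOn).add
      ((continuousOn_const.mul c3.continuousOn).mul hq.continuousOn)
  have h2 := Set.EqOn.of_subset_closure (g := fun _ => (0 : ℝ)) h1 hE continuousOn_const
    Set.inter_subset_left ((dense_tableRegion k).open_subset_closure_inter hΩ)
  exact fun p hp => (condQ_tableParam_iff k q (p, 0)).2 (h2 hp)

theorem isLieSymmetry_tableField_iff_condQ {Ω : Set R3} (hΩ : IsOpen Ω) {q : R3 → ℝ}
    (hq : ContDiffOn ℝ 1 q Ω) {k : Fin 10} :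
    IsLieSymmetry q (Ω ×ˢ Set.univ) (tableField k) ↔ ∀ p ∈ Ω, CondQ (tableParam k) q p := by
  rw [tableField_eq_genField, isLieSymmetry_genField_iff hΩ hq subset_rfl,
    Set.fst_image_prod _ Set.univ_nonempty]

theorem isLieSymmetry_tableField_iff {Ω : Set R3} (hΩ : IsOpen Ω) {q : R3 → ℝ}
    (hq : ContDiffOn ℝ 1 q Ω) {k : Fin 10} :
    IsLieSymmetry q (Ω ×ˢ Set.univ) (tableField k) ↔
      ∀ p ∈ Ω ∩ tableRegion k, ∃ F : ℝ × ℝ → ℝ, ∀ᶠ p' in 𝓝 p, q p' = tablePotential k F p' := by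
  rw [isLieSymmetry_tableField_iff_condQ hΩ hq]
  exact ⟨fun h _ => local_form_of_condQ hΩ hq h, condQ_of_local_form hΩ hq⟩

theorem isLieSymmetry_tableField_iff_global {Ω : Set R3} (hΩ : IsOpen Ω) {q : R3 → ℝ}
    (hq : ContDiffOn ℝ 1 q Ω) {k : Fin 10}
    (hconn : ∀ c, IsPreconnected (Ω ∩ tableRegion k ∩ tableInvariant k ⁻¹' {c})) :
    IsLieSymmetry q (Ω ×ˢ Set.univ) (tableField k) ↔
      ∃ F : ℝ × ℝ → ℝ, ∀ p ∈ Ω ∩ tableRegion k, q p = tablePotential k F p := by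
  rw [isLieSymmetry_tableField_iff hΩ hq]
  constructor
  · intro h
    refine exists_tablePotential Set.inter_subset_right fun p₁ h₁ p₂ h₂ he => ?_
    -- On a level set the local forms make `q / tableFactor` locally constant, hence constant by
    -- connectedness.
    refine (hconn (tableInvariant k p₂)).induction₂
      (fun x y => q x / tableFactor k x = q y / tableFactor k y) (fun x hx => ?_)
      (fun _ _ _ _ _ _ => Eq.trans) (fun _ _ _ _ => Eq.symm) ⟨h₁, he⟩ ⟨h₂, rfl⟩
    obtain ⟨F, hF⟩ := h x hx.1
    filter_upwards [nhdsWithin_le_nhds hF, self_mem_nhdsWithin] with y hy hys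
    rw [hy, hF.self_of_nhds, tablePotential, tablePotential,
      mul_div_cancel_left₀ _ (tableFactor_ne_zero hx.1.2),
      mul_div_cancel_left₀ _ (tableFactor_ne_zero hys.1.2), hx.2, hys.2]
  · rintro ⟨F, hF⟩ p hp
    exact ⟨F, Filter.mem_of_superset
      ((hΩ.inter (isOpen_tableRegion k)).mem_nhds hp) hF⟩

/-! ### First derivatives of transformed functions -/

/-- The linear part of the action of the `k`-th group on the dependent variables. -/
noncomputable def groupMatrix (k : Fin 10) (t : ℝ) (p : R3) (a d : Fin 3) : ℝ :=
  groupQ k t p (Pi.single d 1) a - groupQ k t p 0 a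

/-- The derivative of the action on the dependent variables, at `(p, Q)` in the direction
`(p', Q')`. -/
noncomputable def groupQDeriv (k : Fin 10) (t : ℝ) (p Q p' Q' : R3) : R3 :=
  let c := Real.cos t
  let s := Real.sin t
  let d := groupDen k t p
  let C := cfun p Q
  let C' := -2 * (p' 0 * Q 0 + p 0 * Q' 0 + (p' 1 * Q 1 + p 1 * Q' 1) + (p' 2 * Q 2 + p 2 * Q' 2))
  let r' := 2 * (p 0 * p' 0 + p 1 * p' 1 + p 2 * p' 2)
  let con (i a : Fin 3) := (r' * t ^ 2 - 2 * p' i * t) * Q a + d * Q' a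
    + (p' a * (2 * Q i * t + C * t ^ 2) + p a * (2 * Q' i * t + C' * t ^ 2))
  let diag (i : Fin 3) := Q' i + C' * t
    - (r' * Q i + rsq p * Q' i + (C' * p i + C * p' i)) * t ^ 2
  ![Q', Q', Q',
    ![Q' 0, c * Q' 1 - s * Q' 2, s * Q' 1 + c * Q' 2],
    ![c * Q' 0 + s * Q' 2, Q' 1, -s * Q' 0 + c * Q' 2],
    ![c * Q' 0 - s * Q' 1, s * Q' 0 + c * Q' 1, Q' 2],
    ![Real.exp (-t) * Q' 0, Real.exp (-t) * Q' 1, Real.exp (-t) * Q' 2],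
    ![diag 0, con 0 1, con 0 2],
    ![con 1 0, diag 1, con 1 2],
    ![con 2 0, con 2 1, diag 2]] k

theorem hasDerivAt_groupQ_comp (k : Fin 10) (t : ℝ) {y Q : ℝ → R3} {y' Q' : R3} {s : ℝ}
    (hy : ∀ d, HasDerivAt (fun s => y s d) (y' d) s)
    (hQ : ∀ b, HasDerivAt (fun s => Q s b) (Q' b) s) (a : Fin 3) :
    HasDerivAt (fun s => groupQ k t (y s) (Q s) a) (groupQDeriv k t (y s) (Q s) y' Q' a) s := by
  have hC : HasDerivAt (fun s => cfun (y s) (Q s)) (-2 * (y' 0 * Q s 0 + y s 0 * Q' 0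
      + (y' 1 * Q s 1 + y s 1 * Q' 1) + (y' 2 * Q s 2 + y s 2 * Q' 2))) s :=
    (((((hy 0).mul (hQ 0)).add ((hy 1).mul (hQ 1))).add ((hy 2).mul (hQ 2))).const_mul 2
      |>.const_sub 1).congr_deriv (by ring)
  have hr : HasDerivAt (fun s => rsq (y s)) (2 * (y s 0 * y' 0 + y s 1 * y' 1 + y s 2 * y' 2)) s :=
    ((((hy 0).pow 2).add ((hy 1).pow 2)).add ((hy 2).pow 2)).congr_deriv (by simp; ring)
  have hα : ∀ i, HasDerivAt (fun s => alpha (y s i) (rsq (y s)) t)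
      (2 * (y s 0 * y' 0 + y s 1 * y' 1 + y s 2 * y' 2) * t ^ 2 - 2 * y' i * t) s := fun i =>
    ((hr.mul_const (t ^ 2)).sub (((hy i).const_mul 2).mul_const t)).add_const 1
  have hcon : ∀ i a, HasDerivAt (fun s => alpha (y s i) (rsq (y s)) t * Q s a
      + y s a * (2 * Q s i * t + cfun (y s) (Q s) * t ^ 2)) _ s := fun i a =>
    ((hα i).mul (hQ a)).add ((hy a).mul
      ((((hQ i).const_mul 2).mul_const t).add (hC.mul_const (t ^ 2))))
  have hdiag : ∀ i, HasDerivAt (fun s => Q s i + cfun (y s) (Q s) * t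
      - (rsq (y s) * Q s i + cfun (y s) (Q s) * y s i) * t ^ 2) _ s := fun i =>
    ((hQ i).add (hC.mul_const t)).sub (((hr.mul (hQ i)).add (hC.mul (hy i))).mul_const (t ^ 2))
  fin_cases k
  iterate 3 fin_cases a <;> exact hQ _
  · fin_cases a
    · exact hQ 0
    · exact ((hQ 1).const_mul _).sub ((hQ 2).const_mul _)
    · exact ((hQ 1).const_mul _).add ((hQ 2).const_mul _)
  · fin_cases a
    · exact ((hQ 0).const_mul _).add ((hQ 2).const_mul _)
    · exact hQ 1
    · exact ((hQ 0).const_mul _).add ((hQ 2).const_mul _)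
  · fin_cases a
    · exact ((hQ 0).const_mul _).sub ((hQ 1).const_mul _)
    · exact ((hQ 0).const_mul _).add ((hQ 1).const_mul _)
    · exact hQ 2
  · fin_cases a <;> exact (hQ _).const_mul _
  · fin_cases a
    · exact hdiag 0
    · exact hcon 0 1
    · exact hcon 0 2
  · fin_cases a
    · exact hcon 1 0
    · exact hdiag 1
    · exact hcon 1 2
  · fin_cases a
    · exact hcon 2 0
    · exact hcon 2 1
    · exact hdiag 2

theorem hasDerivAt_of_quadratic_div {f : ℝ → ℝ} {c : ℝ} (n₀ n₁ n₂ m₀ m₁ m₂ : ℝ) (h : m₀ ≠ 0)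
    (hf : ∀ s, f s = (n₀ + n₁ * s + n₂ * s ^ 2) / (m₀ + m₁ * s + m₂ * s ^ 2))
    (hc : c * m₀ ^ 2 = n₁ * m₀ - n₀ * m₁) : HasDerivAt f c 0 := by
  have h3 := (hasDerivAt_quadratic n₀ n₁ n₂ 0).div (hasDerivAt_quadratic m₀ m₁ m₂ 0) (by simpa)
  refine (h3.congr_deriv ?_).congr_of_eventuallyEq (.of_forall hf)
  simp [← hc, h]

theorem alpha_conical_inverse (i : Fin 3) {t : ℝ} {p : R3} (h : groupDen (![7, 8, 9] i) t p ≠ 0) :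
    alpha (groupX (![7, 8, 9] i) t p i) (rsq p / groupDen (![7, 8, 9] i) t p) (-t)
      = (groupDen (![7, 8, 9] i) t p)⁻¹ := by
  have h1 := eq_inv_of_mul_eq_one_left (groupDen_neg_mul h)
  rw [← h1, ← rsq_groupX_conical i h]
  fin_cases i <;> rfl

theorem hasDerivAt_groupX_line_of_lt {k : Fin 10} (hk : k < 7) (t : ℝ) (p : R3) (a d : Fin 3) :
    HasDerivAt (fun s : ℝ => groupX k t (p + s • Pi.single a 1) d)
      (groupMatrix k (-t) (groupX k t p) a d) 0 := by
  refine hasDerivAt_of_quadratic (groupX k t p d) (groupMatrix k (-t) (groupX k t p) a d) 0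
    (fun s => ?_) (by simp)
  fin_cases k <;> simp at hk <;> fin_cases a <;> fin_cases d <;>
    simp [groupX, groupMatrix, groupQ] <;> ring

theorem groupX_conical_line (i a d : Fin 3) (t s : ℝ) (p : R3) :
    groupX (![7, 8, 9] i) t (p + s • Pi.single a 1) d =
      (p d - (if d = i then t * rsq p else 0)
        + ((if a = d then 1 else 0) - if d = i then 2 * t * p a else 0) * s
        + (-if d = i then t else 0) * s ^ 2) /
      (alpha (p i) (rsq p) t + (2 * p a * t ^ 2 - 2 * (if a = i then t else 0)) * s
        + t ^ 2 * s ^ 2) := by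
  have h1 : groupX (![7, 8, 9] i) t (p + s • Pi.single a 1) d
      = ((p + s • Pi.single a 1 : R3) d - if d = i then t * rsq (p + s • Pi.single a 1) else 0) /
        alpha ((p + s • Pi.single a 1 : R3) i) (rsq (p + s • Pi.single a 1)) t := by
    fin_cases i <;> fin_cases d <;> simp [groupX, groupDen]
  have h2 : rsq (p + s • Pi.single a 1) = rsq p + 2 * p a * s + s ^ 2 := by
    fin_cases a <;> simp [rsq] <;> ring
  have h3 : ∀ j, (p + s • Pi.single a 1 : R3) j = p j + if a = j then s else 0 := fun j => by
    simp [Pi.single_apply, eq_comm]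
  rw [h1, h2, h3, h3]
  simp only [alpha]
  congr 1 <;> split_ifs <;> ring

theorem groupMatrix_conical (i a d : Fin 3) (t : ℝ) (p : R3) :
    groupMatrix (![7, 8, 9] i) t p a d = (if a = d then alpha (p i) (rsq p) t else 0)
      + 2 * p a * ((if i = d then t else 0) - p d * t ^ 2)
      + if a = i then -2 * t * p d - 2 * t ^ 2 * ((if i = d then rsq p else 0) - 2 * p d * p i)
      else 0 := by
  fin_cases i <;> fin_cases a <;> fin_cases d <;>
    simp [groupMatrix, groupQ, groupDen, cfun] <;> (try simp only [alpha]) <;> ring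

/-- `Q` transforms as a covector: the linear part of the inverse action at the image point is the
transposed Jacobian of the spatial map. Jacobians are thereby expressed by `groupMatrix`, which has
no denominators. -/
theorem hasDerivAt_groupX_line {k : Fin 10} {t : ℝ} {p : R3} (h : groupDen k t p ≠ 0)
    (a d : Fin 3) :
    HasDerivAt (fun s : ℝ => groupX k t (p + s • Pi.single a 1) d)
      (groupMatrix k (-t) (groupX k t p) a d) 0 := by
  have con : ∀ i : Fin 3, k = ![7, 8, 9] i → HasDerivAt
      (fun s : ℝ => groupX k t (p + s • Pi.single a 1) d)
      (groupMatrix k (-t) (groupX k t p) a d) 0 := fun i hk => by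
    subst hk
    have hD : groupDen (![7, 8, 9] i) t p = alpha (p i) (rsq p) t := by fin_cases i <;> rfl
    have hX : ∀ l, groupX (![7, 8, 9] i) t p l
        = (p l - if l = i then t * rsq p else 0) / alpha (p i) (rsq p) t := fun l => by
      fin_cases i <;> fin_cases l <;> simp [groupX, groupDen]
    refine hasDerivAt_of_quadratic_div _ _ _ _ _ _ (hD ▸ h)
      (fun s => groupX_conical_line i a d t s p) ?_
    rw [groupMatrix_conical, rsq_groupX_conical i h, alpha_conical_inverse i h, hD, hX, hX, hX]
    rw [hD] at h
    obtain ⟨D, hD'⟩ : ∃ D, D = alpha (p i) (rsq p) t := ⟨_, rfl⟩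
    rw [← hD'] at h ⊢
    -- The definition of `alpha`, solved for `r² t²`, is the only relation needed between `D` and
    -- the coordinates.
    have hD2 : rsq p * t ^ 2 = D + 2 * p i * t - 1 := by rw [hD', alpha]; ring
    by_cases hai : a = i
    · subst hai
      by_cases hda : d = a
      · subst hda
        simp
        field_simp
        linear_combination (-2 * t * (p d - t * rsq p)) * hD2
      · simp [hda, Ne.symm hda]
        field_simp
        linear_combination (-t * p d) * hD2
    · by_cases hdi : d = i
      · subst hdi
        simp [hai]
        field_simp
      · by_cases had : a = d
        · subst had
          simp [hai, Ne.symm hai]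
          field_simp
          ring
        · simp [hai, hdi, had, Ne.symm hdi]
          field_simp
  by_cases hk : k < 7
  · exact hasDerivAt_groupX_line_of_lt hk t p a d
  · have : k = 7 ∨ k = 8 ∨ k = 9 := by omega
    rcases this with h7 | h8 | h9
    · exact con 0 h7
    · exact con 1 h8
    · exact con 2 h9

/-- The derivative of the transformed function, as a function of the jet of the given one. -/
noncomputable def groupJet (k : Fin 10) (t : ℝ) (j : Jet) (a c : Fin 3) : ℝ :=
  groupQDeriv k t j.1 j.2.1 (fun d => groupMatrix k t j.1 c d)
    (fun b => groupMatrix k t j.1 c 0 * j.2.2 b 0 + groupMatrix k t j.1 c 1 * j.2.2 b 1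
      + groupMatrix k t j.1 c 2 * j.2.2 b 2) a

theorem groupJet_conical_comm (i : Fin 3) (t : ℝ) (j : Jet) (hj : ∀ a i, j.2.2 a i = j.2.2 i a)
    (a c : Fin 3) : groupJet (![7, 8, 9] i) t j a c = groupJet (![7, 8, 9] i) t j c a := by
  have e1 := hj 2 1
  have e2 := hj 0 2
  have e3 := hj 1 0
  have key : ∀ a c : Fin 3, a < c →
      groupJet (![7, 8, 9] i) t j a c = groupJet (![7, 8, 9] i) t j c a := fun a c hac => by
    simp only [groupJet, groupMatrix_conical]
    fin_cases i <;> fin_cases a <;> fin_cases c <;> simp at hac <;>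
      simp [groupQDeriv, groupDen, e1, e2, e3] <;> simp only [alpha, rsq, cfun] <;> ring
  rcases lt_trichotomy a c with h | h | h
  · exact key a c h
  · rw [h]
  · exact (key c a h).symm

/-- For `Q = -∇ψ/ψ` the expression `-div Q + |Q|²` is `Δψ/ψ`, so this is the conformal covariance of
the Laplacian. For symmetric jets it is a polynomial identity, valid also where `alpha` vanishes. -/
theorem groupJet_conical_trace (i : Fin 3) (t : ℝ) (j : Jet) (hj : ∀ a i, j.2.2 a i = j.2.2 i a) :
    -(groupJet (![7, 8, 9] i) t j 0 0 + groupJet (![7, 8, 9] i) t j 1 1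
        + groupJet (![7, 8, 9] i) t j 2 2)
      + (groupQ (![7, 8, 9] i) t j.1 j.2.1 0 ^ 2 + groupQ (![7, 8, 9] i) t j.1 j.2.1 1 ^ 2
        + groupQ (![7, 8, 9] i) t j.1 j.2.1 2 ^ 2)
      = alpha (j.1 i) (rsq j.1) t ^ 2 * (-(j.2.2 0 0 + j.2.2 1 1 + j.2.2 2 2)
        + (j.2.1 0 ^ 2 + j.2.1 1 ^ 2 + j.2.1 2 ^ 2)) := by
  have e1 := hj 2 1
  have e2 := hj 0 2
  have e3 := hj 1 0
  simp only [groupJet, groupMatrix_conical]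
  fin_cases i <;>
    simp [groupQDeriv, groupQ, groupDen, e1, e2, e3] <;> simp only [alpha, rsq, cfun] <;> ring

theorem groupJet_comm (k : Fin 10) (t : ℝ) (j : Jet) (hj : ∀ a i, j.2.2 a i = j.2.2 i a)
    (a c : Fin 3) : groupJet k t j a c = groupJet k t j c a := by
  have e1 := hj 2 1
  have e2 := hj 0 2
  have e3 := hj 1 0
  have key : k < 7 → ∀ a c : Fin 3, a < c → groupJet k t j a c = groupJet k t j c a :=
    fun hk a c hac => by
      fin_cases a <;> fin_cases c <;> simp at hac <;> fin_cases k <;> simp at hk <;>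
        simp [groupJet, groupQDeriv, groupMatrix, groupQ, e1, e2, e3] <;> ring
  by_cases hk : k < 7
  · rcases lt_trichotomy a c with h | h | h
    · exact key hk a c h
    · rw [h]
    · exact (key hk c a h).symm
  · have : k = 7 ∨ k = 8 ∨ k = 9 := by omega
    rcases this with rfl | rfl | rfl
    · exact groupJet_conical_comm 0 t j hj a c
    · exact groupJet_conical_comm 1 t j hj a c
    · exact groupJet_conical_comm 2 t j hj a c

theorem groupJet_trace (k : Fin 10) (t : ℝ) (j : Jet) (hj : ∀ a i, j.2.2 a i = j.2.2 i a) :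
    -(groupJet k t j 0 0 + groupJet k t j 1 1 + groupJet k t j 2 2)
      + (groupQ k t j.1 j.2.1 0 ^ 2 + groupQ k t j.1 j.2.1 1 ^ 2 + groupQ k t j.1 j.2.1 2 ^ 2)
      = groupWeight k t j.1 * (-(j.2.2 0 0 + j.2.2 1 1 + j.2.2 2 2)
        + (j.2.1 0 ^ 2 + j.2.1 1 ^ 2 + j.2.1 2 ^ 2)) := by
  have e1 := hj 2 1
  have e2 := hj 0 2
  have e3 := hj 1 0
  have hc := Real.cos_sq_add_sin_sq t
  fin_cases k
  iterate 3 simp [groupJet, groupQDeriv, groupMatrix, groupQ, groupWeight]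
  · simp [groupJet, groupQDeriv, groupMatrix, groupQ, groupWeight, e1]
    linear_combination (-(j.2.2 1 1 + j.2.2 2 2) + (j.2.1 1 ^ 2 + j.2.1 2 ^ 2)) * hc
  · simp [groupJet, groupQDeriv, groupMatrix, groupQ, groupWeight, e2]
    linear_combination (-(j.2.2 0 0 + j.2.2 2 2) + (j.2.1 0 ^ 2 + j.2.1 2 ^ 2)) * hc
  · simp [groupJet, groupQDeriv, groupMatrix, groupQ, groupWeight, e3]
    linear_combination (-(j.2.2 0 0 + j.2.2 1 1) + (j.2.1 0 ^ 2 + j.2.1 1 ^ 2)) * hc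
  · simp [groupJet, groupQDeriv, groupMatrix, groupQ, groupWeight, two_mul, Real.exp_add]
    ring
  · exact groupJet_conical_trace 0 t j hj
  · exact groupJet_conical_trace 1 t j hj
  · exact groupJet_conical_trace 2 t j hj

/-! ### Transformation of solutions -/

theorem contDiff_groupQ (k : Fin 10) (t : ℝ) :
    ContDiff ℝ ∞ fun P : R3 × R3 => groupQ k t P.1 P.2 := by
  refine contDiff_pi.2 fun l => ?_
  fin_cases k <;> fin_cases l <;> simp [groupQ, groupDen, alpha, rsq, cfun] <;> fun_prop

theorem contDiffAt_groupX_right {k : Fin 10} {t : ℝ} {p : R3} (h : groupDen k t p ≠ 0) :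
    ContDiffAt ℝ ∞ (groupX k t) p :=
  ContDiffAt.comp (g := fun s : ℝ × R3 => groupX k s.1 s.2) (f := fun x : R3 => (t, x)) p
    (contDiffAt_groupX (s := (t, p)) h) (by fun_prop)

theorem continuous_groupDen (k : Fin 10) (t : ℝ) : Continuous (groupDen k t) :=
  Continuous.comp (g := fun s : ℝ × R3 => groupDen k s.1 s.2) (f := fun x : R3 => (t, x))
    (contDiff_groupDen k).continuous (by fun_prop)

/-- Writing the image as a preimage under the inverse makes its openness a matter of continuity. -/
theorem image_groupX {k : Fin 10} {t : ℝ} {U : Set R3} (hden : ∀ p ∈ U, groupDen k t p ≠ 0) :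
    groupX k t '' U = {x | groupDen k (-t) x ≠ 0 ∧ groupX k (-t) x ∈ U} := by
  ext x
  constructor
  · rintro ⟨p, hp, rfl⟩
    refine ⟨left_ne_zero_of_mul_eq_one (groupDen_neg_mul (hden p hp)), ?_⟩
    rwa [groupX_neg (hden p hp)]
  · rintro ⟨h1, h2⟩
    refine ⟨_, h2, ?_⟩
    have := groupX_neg h1
    rwa [neg_neg] at this

theorem isOpen_image_groupX {k : Fin 10} {t : ℝ} {U : Set R3} (hU : IsOpen U)
    (hden : ∀ p ∈ U, groupDen k t p ≠ 0) : IsOpen (groupX k t '' U) := by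
  rw [image_groupX hden, isOpen_iff_mem_nhds]
  rintro x ⟨h1, h2⟩
  exact ((continuous_groupDen k (-t)).continuousAt.eventually_ne h1).and
    ((contDiffAt_groupX_right h1).continuousAt.eventually_mem (hU.mem_nhds h2))

theorem contDiffAt_transform {k : Fin 10} {t : ℝ} {Q : R3 → R3} {x : R3}
    (h : groupDen k (-t) x ≠ 0) (hQ : ContDiffAt ℝ 1 Q (groupX k (-t) x)) :
    ContDiffAt ℝ 1 (transform k t Q) x := by
  have hX : ContDiffAt ℝ 1 (groupX k (-t)) x := (contDiffAt_groupX_right h).of_le (by simp)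
  exact ContDiffAt.comp (g := fun P : R3 × R3 => groupQ k t P.1 P.2)
    (f := fun x => (groupX k (-t) x, Q (groupX k (-t) x))) x
    ((contDiff_groupQ k t).contDiffAt.of_le (by simp)) (hX.prodMk (hQ.comp x hX))

theorem hasDerivAt_apply_comp {y : ℝ → R3} {G : R3 → R3} {x y' : R3} {b : Fin 3}
    (hG : DifferentiableAt ℝ G x) (h0 : y 0 = x)
    (hy : ∀ d, HasDerivAt (fun s => y s d) (y' d) 0) :
    HasDerivAt (fun s => G (y s) b) (fderiv ℝ (fun z => G z b) x y') 0 := by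
  subst h0
  exact (differentiableAt_pi.1 hG b).hasFDerivAt.comp_hasDerivAt (0 : ℝ) (hasDerivAt_pi.2 hy)

/-- The chain rule, with `hasDerivAt_groupX_line` at parameter `-t` supplying the Jacobian of the
inverse map. -/
theorem pd_transform {k : Fin 10} {t : ℝ} {Q : R3 → R3} {x : R3}
    (h : groupDen k (-t) x ≠ 0) (hQ : ContDiffAt ℝ 1 Q (groupX k (-t) x)) (a c : Fin 3) :
    pd c (fun x => transform k t Q x a) x = groupJet k t (jetOf Q (groupX k (-t) x)) a c := by
  have hT := (contDiffAt_transform h hQ).differentiableAt one_ne_zero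
  refine fderiv_apply_eq_of_hasDerivAt_line (differentiableAt_pi.1 hT a) ?_
  have h0 : x + (0 : ℝ) • (Pi.single c 1 : R3) = x := by simp
  have hy : ∀ d, HasDerivAt (fun s : ℝ => groupX k (-t) (x + s • Pi.single c 1) d)
      (groupMatrix k t (groupX k (-t) x) c d) 0 := fun d => by
    have := hasDerivAt_groupX_line h c d
    rwa [neg_neg] at this
  have hQb : ∀ b, HasDerivAt (fun s : ℝ => Q (groupX k (-t) (x + s • Pi.single c 1)) b)
      (fderiv ℝ (fun y => Q y b) (groupX k (-t) x)
        (fun d => groupMatrix k t (groupX k (-t) x) c d)) 0 := fun b =>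
    hasDerivAt_apply_comp (y := fun s : ℝ => groupX k (-t) (x + s • Pi.single c 1))
      (y' := fun d => groupMatrix k t (groupX k (-t) x) c d)
      (hQ.differentiableAt one_ne_zero) (congrArg (groupX k (-t)) h0) hy
  have h2 := hasDerivAt_groupQ_comp k t
    (y := fun s : ℝ => groupX k (-t) (x + s • Pi.single c 1))
    (Q := fun s : ℝ => Q (groupX k (-t) (x + s • Pi.single c 1)))
    (y' := fun d => groupMatrix k t (groupX k (-t) x) c d)
    (Q' := fun b => fderiv ℝ (fun y => Q y b) (groupX k (-t) x)
      (fun d => groupMatrix k t (groupX k (-t) x) c d)) hy hQb a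
  simp only [h0, fderiv_eq_sum_pd] at h2
  simp only [transform, groupJet, jetOf]
  exact h2

/-- The group maps solutions to solutions as soon as it multiplies the potential by the weight. -/
theorem mapsSolutions_of_weight {q : R3 → ℝ} {k : Fin 10} {t : ℝ} {U : Set R3} (hU : IsOpen U)
    (hden : ∀ p ∈ U, groupDen k t p ≠ 0)
    (hw : ∀ p ∈ U, q (groupX k t p) = groupWeight k t p * q p) : MapsSolutions q k t U := by
  refine ⟨isOpen_image_groupX hU hden, fun Q hQ => ⟨⟨fun x hx => ?_, ?_⟩, fun p hp => ?_⟩⟩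
  · rw [image_groupX hden] at hx
    exact (contDiffAt_transform hx.1 (hQ.1.contDiffAt (hU.mem_nhds hx.2))).contDiffWithinAt
  · rintro _ ⟨y, hy, rfl⟩
    have hd := left_ne_zero_of_mul_eq_one (groupDen_neg_mul (hden y hy))
    have hX := groupX_neg (hden y hy)
    have hpd := fun a c => pd_transform (t := t) (Q := Q) hd
      (by rw [hX]; exact hQ.1.contDiffAt (hU.mem_nhds hy)) a c
    rw [hX] at hpd
    obtain ⟨h0, h1⟩ := riccati_eq_zero_iff.1 (hQ.2 y hy)
    refine riccati_eq_zero_iff.2 ⟨?_, fun a i => ?_⟩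
    · have htr := groupJet_trace k t (jetOf Q y) h1
      simp only [jetOf] at h0 htr hpd ⊢
      have hT : transform k t Q (groupX k t y) = groupQ k t y (Q y) := by rw [transform, hX]
      simp only [hpd, hw y hy, hT]
      -- The first equation at the image point is the weight times the first equation at `y`.
      linear_combination -htr + groupWeight k t y * h0
    · simp only [jetOf] at hpd ⊢
      rw [hpd, hpd]
      exact groupJet_comm k t (jetOf Q y) h1 a i
  · rw [transform, groupX_neg (hden p hp)]

theorem continuous_groupWeight (k : Fin 10) (t : ℝ) : Continuous (groupWeight k t) := by
  unfold groupWeight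
  fin_cases k <;> simp [alpha, rsq] <;> fun_prop

/-- A potential of the form of the table is multiplied by the weight, also off the region in which
that form is defined. -/
theorem weight_of_form {Ω : Set R3} {q : R3 → ℝ} (hq : ContinuousOn q Ω) {k : Fin 10} {t : ℝ}
    {U : Set R3} (hU : IsOpen U) (hUΩ : U ⊆ Ω) {F : ℝ × ℝ → ℝ}
    (hF : ∀ p ∈ Ω ∩ tableRegion k, q p = tablePotential k F p)
    (h : ∀ p ∈ U, groupDen k t p ≠ 0 ∧ groupX k t p ∈ Ω) :
    ∀ p ∈ U, q (groupX k t p) = groupWeight k t p * q p := by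
  have h1 : Set.EqOn (fun p => q (groupX k t p)) (fun p => groupWeight k t p * q p)
      (U ∩ tableRegion k) := fun p hp => by
    obtain ⟨hd, hm⟩ := h p hp.1
    show q (groupX k t p) = groupWeight k t p * q p
    rw [hF _ ⟨hm, groupX_mem_tableRegion hp.2 hd⟩, hF p ⟨hUΩ hp.1, hp.2⟩,
      tablePotential_groupX F hd]
  have hX : ContinuousOn (groupX k t) U := fun p hp =>
    (contDiffAt_groupX_right (h p hp).1).continuousAt.continuousWithinAt
  exact Set.EqOn.of_subset_closure h1 (hq.comp hX fun p hp => (h p hp).2)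
    ((continuous_groupWeight k t).continuousOn.mul (hq.mono hUΩ)) Set.inter_subset_left
    ((dense_tableRegion k).open_subset_closure_inter hU)

/-- On the axis `alpha` is the square `(1 - x_i t)²`, and the numerator of the moving coordinate
cancels one factor. -/
theorem conical_axis (i : Fin 3) (t : ℝ) (p Q : R3) (hp : ∀ l, l ≠ i → p l = 0)
    (h : 1 - p i * t ≠ 0) :
    groupX (![7, 8, 9] i) t p = Pi.single i (p i / (1 - p i * t)) ∧
      groupQ (![7, 8, 9] i) t p Q = fun l =>
        if l = i then (1 - p i * t) * (Q i + t * (1 - p i * Q i)) else Q l * (1 - p i * t) ^ 2 := by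
  have hr : rsq p = p i ^ 2 := by
    fin_cases i
    · simp [rsq, hp 1, hp 2]
    · simp [rsq, hp 0, hp 2]
    · simp [rsq, hp 0, hp 1]
  have hα : alpha (p i) (p i ^ 2) t = (1 - p i * t) ^ 2 := by simp only [alpha]; ring
  constructor
  · ext l
    -- At `s = 0` the line formula gives the coordinates of the map itself; the direction index `0`
    -- plays no role.
    have h1 := groupX_conical_line i 0 l t 0 p
    simp [hr, hα] at h1
    rw [h1, Pi.single_apply]
    by_cases hl : l = i
    · subst hl
      simp
      field_simp
    · simp [hl, hp l hl]
  · ext l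
    fin_cases i
    · have h1 := hp 1 (by decide)
      have h2 := hp 2 (by decide)
      simp at hr hα
      fin_cases l <;> simp [groupQ, groupDen, hr, hα, h1, h2, cfun] <;> ring
    · have h1 := hp 0 (by decide)
      have h2 := hp 2 (by decide)
      simp at hr hα
      fin_cases l <;> simp [groupQ, groupDen, hr, hα, h1, h2, cfun] <;> ring
    · have h1 := hp 0 (by decide)
      have h2 := hp 1 (by decide)
      simp at hr hα
      fin_cases l <;> simp [groupQ, groupDen, hr, hα, h1, h2, cfun] <;> ring

end Riccati3D

open Riccati3D

theorem mainTheorem5 (Ω : Set R3) (hΩ : IsOpen Ω) (q : R3 → ℝ) (hq : ContDiffOn ℝ 1 q Ω) :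
    -- classification of the generators, and the condition on the potential
    (∀ M : Set (R3 × R3), IsOpen M → IsConnected M → M ⊆ Ω ×ˢ Set.univ → ∀ X : VField,
      (IsLieSymmetry q M X ↔
        ∃! a : Fin 10 → ℝ, (∀ m ∈ M, X m = genField a m) ∧ ∀ p ∈ Prod.fst '' M, CondQ a q p)) ∧
    -- the ten-parameter field as a combination of the ten fields of the table
    (∀ (a : Fin 10 → ℝ) (m : R3 × R3),
      genField a m =
        a 8 • tableField 0 m + a 9 • tableField 1 m + a 7 • tableField 2 m
        + a 6 • tableField 3 m - a 3 • tableField 4 m + a 5 • tableField 5 m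
        + a 4 • tableField 6 m
        + a 0 • tableField 7 m + a 1 • tableField 8 m + a 2 • tableField 9 m) ∧
    -- the potentials admitted by each field: local form, and global form on suitable domains
    (∀ k : Fin 10,
      (IsLieSymmetry q (Ω ×ˢ Set.univ) (tableField k) ↔
        ∀ p ∈ Ω ∩ tableRegion k, ∃ F : ℝ × ℝ → ℝ, ∀ᶠ p' in 𝓝 p, q p' = tablePotential k F p') ∧
      ((∀ c : ℝ × ℝ, IsPreconnected (Ω ∩ tableRegion k ∩ tableInvariant k ⁻¹' {c})) →
        (IsLieSymmetry q (Ω ×ˢ Set.univ) (tableField k) ↔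
          ∃ F : ℝ × ℝ → ℝ, ∀ p ∈ Ω ∩ tableRegion k, q p = tablePotential k F p))) ∧
    -- the groups are the flows of the fields of the table
    (∀ (k : Fin 10) (p Q : R3),
      groupX k 0 p = p ∧ groupQ k 0 p Q = Q ∧
      ∀ t : ℝ, groupDen k t p ≠ 0 →
        HasDerivAt (fun s => (groupX k s p, groupQ k s p Q))
          (tableField k (groupX k t p, groupQ k t p Q)) t) ∧
    -- the form of the conical groups on the exceptional axes
    (∀ (i : Fin 3) (t : ℝ) (p Q : R3), (∀ l, l ≠ i → p l = 0) → 1 - p i * t ≠ 0 →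
      groupX (![7, 8, 9] i) t p = Pi.single i (p i / (1 - p i * t)) ∧
      groupQ (![7, 8, 9] i) t p Q = fun l =>
        if l = i then (1 - p i * t) * (Q i + t * (1 - p i * Q i)) else Q l * (1 - p i * t) ^ 2) ∧
    -- the groups map solutions to solutions
    (∀ (k : Fin 10) (t : ℝ) (U : Set R3), IsOpen U → U ⊆ Ω →
      (IsLieSymmetry q (Ω ×ˢ Set.univ) (tableField k) →
        (∀ p ∈ U, ∀ s ∈ Set.uIcc 0 t, groupDen k s p ≠ 0 ∧ groupX k s p ∈ Ω) →
          MapsSolutions q k t U) ∧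
      (∀ F : ℝ × ℝ → ℝ, (∀ p ∈ Ω ∩ tableRegion k, q p = tablePotential k F p) →
        (∀ p ∈ U, groupDen k t p ≠ 0 ∧ groupX k t p ∈ Ω) →
          MapsSolutions q k t U)) := by
  refine ⟨fun M hMo hMc hM X => isLieSymmetry_iff_existsUnique hΩ hq hMo hMc hM X,
    genField_eq_sum, fun k => ⟨isLieSymmetry_tableField_iff hΩ hq,
      fun hc => isLieSymmetry_tableField_iff_global hΩ hq hc⟩,
    fun k p Q => ⟨groupX_zero k p, groupQ_zero k p Q, fun t ht =>
      (hasDerivAt_groupX (groupQ k t p Q) ht).prodMk (hasDerivAt_groupQ ht)⟩,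
    fun i t p Q hp h => conical_axis i t p Q hp h,
    fun k t U hU hUΩ => ⟨fun hX hp => ?_, fun F hF hp => ?_⟩⟩
  · have hc := (isLieSymmetry_tableField_iff_condQ hΩ hq).1 hX
    exact mapsSolutions_of_weight hU (fun p hpU => (hp p hpU t Set.right_mem_uIcc).1)
      fun p hpU => potential_groupX hΩ hq hc (hp p hpU)
  · exact mapsSolutions_of_weight hU (fun p hpU => (hp p hpU).1)
      (weight_of_form hq.continuousOn hU hUΩ hF hp)
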